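/- Let $\{0,1\}^*$ be identified with $\mathbb N$ by the length-lexicographic correspondence, and let $W_0,W_1,\dots$ be the standard numbering of the r.e. subsets of $\mathbb N$. A set $A\subseteq\mathbb N$ is *effectively simple* if it is r.e., its complement $\overline A$ is infinite, and there is a total recursive function $f$ such that for every $e$, $W_e\subseteq\overline A$ implies $|W_e|\le f(e)$. It is *T-complete* if it is r.e. and every r.e. set is Turing reducible to it. For a partial recursive $U:\{0,1\}^*\times\{0,1\}^*\to\{0,1\}^*\cup\{\perp\}$ let $C_U(x)$ be the least length of a $p$ with $U(p,\lambda)=x$, where $\lambda$ is the empty string; let $ic_U(x:A)$ be the least length of a $p$ such that $z\mapsto U(p,z)$ is total, takes at every $z$ the value $\chi_A(z)$ or $\perp$, and has the value $\chi_A(x)$ at $x$; and let $\overline{ic}_U(x:A)$ be defined as $ic_U(x:A)$, but with totality dropped and the value $\chi_A(z)$ or $\perp$ required only at those $z$ where $U(p,z)$ is defined. (Each is $\infty$ if there is no such $p$.) $U$ is *optimal* if for every partial recursive $V$ of the same kind there is a constant $c$ such that $C_U(x)\le C_V(x)+c$, $ic_U(x:A)\le ic_V(x:A)+c$ and $\overline{ic}_U(x:A)\le\overline{ic}_V(x:A)+c$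 for all strings $x$ and all $A\subseteq\{0,1\}^*$. For an optimal $U$, the set $A$ *has hard instances* with respect to $U$ if there is a constant $c$ with $ic_U(x:A)\ge C_U(x)-c$ for infinitely many $x$. **Theorem.** Every effectively simple set is T-complete. Moreover, there is an effectively simple (hence T-complete and nonrecursive) set $A$ such that for every optimal $U$ there is a constant $c$ with $$ic_U(x:A)\le\tfrac23\,C_U(x)+c\qquad\text{for all } x\in\{0,1\}^*,$$ and $A$ does not have hard instances with respect to $U$. Thus the Instance Complexity Conjecture (every nonrecursive r.e. set has hard instances) fails for some T-complete set. -/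

import Mathlib

open scoped ENNReal

noncomputable section

namespace InstanceComplexity

/-- Binary strings, the elements of `{0,1}*`. -/
abbrev Str : Type := List Bool

/-- The canonical (length-lexicographic) correspondence between binary strings and natural
numbers: the empty string is `0`, then `0 ↦ 1`, `1 ↦ 2`, `00 ↦ 3`, `01 ↦ 4`, `10 ↦ 5`, … -/
def strNum (x : Str) : ℕ := x.foldl (fun n b => 2 * n + 1 + b.toNat) 0

theorem strNum_concat (x : Str) (b : Bool) :
    strNum (x ++ [b]) = 2 * strNum x + 1 + b.toNat := by
  simp [strNum]

theorem strNum_bijective : Function.Bijective strNum := by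
  constructor
  · intro x
    induction x using List.reverseRecOn with
    | nil =>
      intro y h
      induction y using List.reverseRecOn with
      | nil => rfl
      | append_singleton y b _ =>
        rw [strNum_concat] at h
        simp only [strNum, List.foldl_nil] at h
        omega
    | append_singleton x a ih =>
      intro y h
      induction y using List.reverseRecOn with
      | nil =>
        rw [strNum_concat] at h
        simp only [strNum, List.foldl_nil] at h
        omega
      | append_singleton y b _ =>
        rw [strNum_concat, strNum_concat] at h
        have hab : a = b := by cases a <;> cases b <;> simp at h ⊢ <;> omega
        subst hab
        rw [ih (show strNum x = strNum y by omega)]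
  · intro n
    induction n using Nat.strong_induction_on with
    | _ n ih =>
      rcases Nat.eq_zero_or_pos n with rfl | hn
      · exact ⟨[], rfl⟩
      · obtain ⟨x, hx⟩ := ih ((n - 1) / 2) (by omega)
        rcases Nat.mod_two_eq_zero_or_one (n - 1) with h | h
        · refine ⟨x ++ [false], ?_⟩
          rw [strNum_concat, hx, Bool.toNat_false]
          omega
        · refine ⟨x ++ [true], ?_⟩
          rw [strNum_concat, hx, Bool.toNat_true]
          omega

/-- The type of partial mappings `{0,1}* × {0,1}* → {0,1}* ∪ {⊥}`.
The "don't know" output `⊥` is `none`; a string output `y` is `some y`. Divergence is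
expressed by the partiality of the function. -/
abbrev Interpreter : Type := Str → Str →. Option Str

/-- Kolmogorov complexity of `x` in `U`: the least length of a `p` with `U(p, λ) = x`,
and `⊤` if there is none. -/
def kolm (U : Interpreter) (x : Str) : ℕ∞ :=
  ⨅ p ∈ {p : Str | some x ∈ U p []}, (p.length : ℕ∞)

open Classical in
/-- The value `χ_A(z)`, as one of the strings `0`, `1`. -/
def chi (A : Set Str) (z : Str) : Str := [decide (z ∈ A)]

/-- A partial function `f` is `A`-consistent: every value of `f` is `χ_A(z)` or `⊥`. -/
def Consistent (A : Set Str) (f : Str →. Option Str) : Prop :=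
  ∀ z, ∀ y ∈ f z, y = some (chi A z) ∨ y = none

/-- Instance complexity `ic_U(x : A)`: the least length of a `p` such that `z ↦ U(p, z)` is
total and `A`-consistent and `U(p, x) = χ_A(x)`; it is `⊤` if there is no such `p`. -/
def ic (U : Interpreter) (A : Set Str) (x : Str) : ℕ∞ :=
  ⨅ p ∈ {p : Str | (∀ z, (U p z).Dom) ∧ Consistent A (U p) ∧ some (chi A x) ∈ U p x},
    (p.length : ℕ∞)

/-- Weak instance complexity: as `ic`, without the requirement of totality. -/
def weakIc (U : Interpreter) (A : Set Str) (x : Str) : ℕ∞ :=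
  ⨅ p ∈ {p : Str | Consistent A (U p) ∧ some (chi A x) ∈ U p x}, (p.length : ℕ∞)

/-- `U` is partial recursive and optimal, up to an additive constant, for all three
complexity measures; the constant depends only on the competing interpreter `V`. -/
def IsOptimal (U : Interpreter) : Prop :=
  Partrec₂ U ∧ ∀ V : Interpreter, Partrec₂ V → ∃ c : ℕ,
    (∀ x, kolm U x ≤ kolm V x + c) ∧
    (∀ A x, ic U A x ≤ ic V A x + c) ∧
    (∀ A x, weakIc U A x ≤ weakIc V A x + c)

/-- `A` has hard instances (with respect to `U`): for some constant `c`,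
`ic(x : A) ≥ C(x) - c` for infinitely many `x`. -/
def HasHardInstances (U : Interpreter) (A : Set Str) : Prop :=
  ∃ c : ℕ, {x : Str | kolm U x ≤ ic U A x + c}.Infinite

/-- The `e`-th recursively enumerable set: the domain of the `e`-th partial recursive function. -/
def W (e : ℕ) : Set ℕ := {n | (Nat.Partrec.Code.eval (Denumerable.ofNat Nat.Partrec.Code e) n).Dom}

/-- `A` is effectively simple: coinfinite, r.e., and for some total recursive `f`, every r.e. set
`W e` contained in the complement of `A` is finite with at most `f e` elements. -/
def EffectivelySimple (A : Set ℕ) : Prop :=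
  REPred (fun n => n ∈ A) ∧ Aᶜ.Infinite ∧
    ∃ f : ℕ → ℕ, Computable f ∧ ∀ e, W e ⊆ Aᶜ → (W e).encard ≤ (f e : ℕ∞)

open Classical in
/-- The characteristic function of `A ⊆ ℕ`. -/
def charFn (A : Set ℕ) : ℕ →. ℕ := fun n => Part.some (if n ∈ A then 1 else 0)

/-- `A` is Turing complete: r.e., and every r.e. set is Turing reducible to `A`. -/
def TComplete (A : Set ℕ) : Prop :=
  REPred (fun n => n ∈ A) ∧
    ∀ B : Set ℕ, REPred (fun n => n ∈ B) → TuringReducible (charFn B) (charFn A)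

end InstanceComplexity

end

open InstanceComplexity

open Nat.Partrec (Code)
open Nat.Partrec.Code (eval evaln curry)

namespace InstanceComplexity

/-! ### Primitive recursive preliminaries -/

/-! Effectively simple sets are T-complete by the recursion theorem. For each `n` there is an r.e.
set with known index `e` that stays empty until `n` enters `B`, and then consists of the first `f e
+ 1` numbers not yet in `A`. It cannot lie in the complement of `A`. So `n` cannot enter `B` once
the enumeration of `A` has settled on an initial segment with `f e + 1` nonmembers
(`exists_settling_bound`), and `A` can find such a stage.

For the counterexample, the values of a universal function at all `i < 8 ^ k` are attacked at level
`k`. A string of complexity `m` is thus attacked at some level `k = m / 3 + O(1)`, and it suffices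
that a program of length `2 * k + O(1)` decides it. The count of all attacks of level `k` would need
`3 * k` bits, so attacks are grouped into at most `4 ^ k` rounds of `2 ^ k` attacks each. The
candidates for the complement form a list with priority bounds. Bounds never rise, and an entry of
bound `p` is dropped only by rounds of level below `p`. Hence a candidate of bound at most `h` is
safe once the rounds of level below `h` are over.

Let `x` be attacked at level `k` (`ic_interp_le_of_attack`). If a round of level `k` ends after `x`
has entered, that round drops `x` or gives it a bound at most `k`. The number of rounds of level at
most `k` is then enough information. Otherwise the attack itself gives `x` a bound at most `k / 2`
if `x` is still listed. Now about `k` bits code the number of rounds of level below `k / 2`, and `k`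
more bits code the position inside the unfinished round, which identifies a stage after the attack.

A round of level `k` spares the first `k` entries and each level is active only finitely often, so
the complement is infinite (`infinite_compl_dropped`). Only boundedly many entries ever have bound
at most `k` at one time (`countP_live_le`), so a late round of level `k` drops an element of any
larger set. A recursive function can provoke such a round through `2 ^ k` indices with the same
value. This gives effective simplicity (`effectivelySimple_dropped`). -/

theorem primrec_pow : Primrec₂ ((· ^ ·) : ℕ → ℕ → ℕ) :=
  Primrec₂.unpaired'.1 Nat.Primrec.pow

theorem primrec_count {α : Type*} [Primcodable α] {p : α → ℕ → Bool} (hp : Primrec₂ p)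
    {f : α → ℕ} (hf : Primrec f) : Primrec fun a => Nat.count (fun x => p a x = true) (f a) := by
  have h : Primrec₂ fun (a : α) (r : ℕ × ℕ) => r.2 + bif p a r.1 then 1 else 0 :=
    Primrec.nat_add.comp (Primrec.snd.comp Primrec.snd)
      (Primrec.cond (hp.comp Primrec.fst (Primrec.fst.comp Primrec.snd))
        (Primrec.const 1) (Primrec.const 0))
  refine (Primrec.nat_rec' hf (Primrec.const 0) h).of_eq fun a => ?_
  induction f a with
  | zero => rfl
  | succ n ih =>
    change _ + _ = _
    rw [Nat.count_succ]
    simp only [] at ih ⊢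
    rw [ih]
    cases p a n <;> simp

/-! ### Stages of recursive enumerations -/

/-- The input `x` is accepted by the code `c` within `s` steps. -/
def stageMem (c : Code) (s x : ℕ) : Bool := (evaln s c x).isSome

theorem stageMem_lt {c : Code} {s x : ℕ} (h : stageMem c s x = true) : x < s := by
  obtain ⟨y, hy⟩ := Option.isSome_iff_exists.1 h
  exact Nat.Partrec.Code.evaln_bound hy

theorem stageMem_mono {c : Code} {s t x : ℕ} (hst : s ≤ t) (h : stageMem c s x = true) :
    stageMem c t x = true := by
  obtain ⟨y, hy⟩ := Option.isSome_iff_exists.1 h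
  exact Option.isSome_iff_exists.2 ⟨y, Nat.Partrec.Code.evaln_mono hst hy⟩

theorem exists_stageMem_iff {c : Code} {x : ℕ} : (∃ s, stageMem c s x = true) ↔ (eval c x).Dom := by
  constructor
  · rintro ⟨s, h⟩
    obtain ⟨y, hy⟩ := Option.isSome_iff_exists.1 h
    exact Part.dom_iff_mem.2 ⟨y, Nat.Partrec.Code.evaln_sound hy⟩
  · intro h
    obtain ⟨y, hy⟩ := Part.dom_iff_mem.1 h
    obtain ⟨s, hs⟩ := Nat.Partrec.Code.evaln_complete.1 hy
    exact ⟨s, Option.isSome_iff_exists.2 ⟨y, hs⟩⟩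

theorem primrec_stageMem : Primrec fun a : (ℕ × Code) × ℕ => stageMem a.1.2 a.1.1 a.2 :=
  Primrec.option_isSome.comp Nat.Partrec.Code.primrec_evaln

theorem exists_code_of_rePred {A : Set ℕ} (hA : REPred fun n => n ∈ A) :
    ∃ c : Code, ∀ x, x ∈ A ↔ ∃ s, stageMem c s x = true := by
  obtain ⟨c, hc⟩ := Code.exists_code.1 (Partrec.nat_iff.1
    (hA.map ((Computable.const 0).to₂ : Computable₂ fun (_ : ℕ) (_ : Unit) => 0)))
  refine ⟨c, fun x => ?_⟩
  rw [exists_stageMem_iff, hc]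
  simp [Part.assert]

theorem exists_stage_bound {A : Set ℕ} {c : Code}
    (hc : ∀ x, x ∈ A ↔ ∃ s, stageMem c s x = true) (u : ℕ) :
    ∃ t, ∀ x < u, (stageMem c t x = true ↔ x ∈ A) := by
  induction u with
  | zero => exact ⟨0, by simp⟩
  | succ u ih =>
    obtain ⟨t, ht⟩ := ih
    by_cases hu : u ∈ A
    · obtain ⟨s, hs⟩ := (hc u).1 hu
      refine ⟨max s t, fun x hx => ⟨fun h => (hc x).2 ⟨_, h⟩, fun h => ?_⟩⟩
      rcases Nat.lt_succ_iff_lt_or_eq.1 hx with hx | rfl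
      · exact stageMem_mono (le_max_right _ _) ((ht x hx).2 h)
      · exact stageMem_mono (le_max_left _ _) hs
    · refine ⟨t, fun x hx => ⟨fun h => (hc x).2 ⟨_, h⟩, fun h => ?_⟩⟩
      rcases Nat.lt_succ_iff_lt_or_eq.1 hx with hx | rfl
      · exact (ht x hx).2 h
      · exact absurd h hu

/-- The counts of a stage `t` and of the whole set agree below `u` only if the sets do. -/
theorem mem_of_count_eq {p q : ℕ → Prop} [DecidablePred p] [DecidablePred q] (hpq : ∀ x, p x → q x)
    {u : ℕ} (h : Nat.count p u = Nat.count q u) {x : ℕ} (hx : x < u) (hq : q x) : p x := by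
  rw [Nat.count_eq_card_filter_range, Nat.count_eq_card_filter_range] at h
  have hs : (Finset.range u).filter p ⊆ (Finset.range u).filter q :=
    Finset.monotone_filter_right _ fun x hx => hpq x
  have he := Finset.eq_of_subset_of_card_le hs h.ge
  have : x ∈ (Finset.range u).filter q := by simp [hx, hq]
  rw [← he] at this
  exact (Finset.mem_filter.1 this).2

/-! ### Effectively simple sets are Turing complete -/

/-- The reduction consults the oracle only through these counts: a stage agrees with `A` below `u`
as soon as the two counts do (`mem_of_count_eq`). -/
theorem recursiveIn_count (A : Set ℕ) [DecidablePred (· ∈ A)] :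
    Nat.RecursiveIn {charFn A} fun u => Part.some (Nat.count (· ∈ A) u) := by
  have hz : Nat.RecursiveIn {charFn A} fun _ => (0 : Part ℕ) := .zero
  have hχ : Nat.RecursiveIn {charFn A} fun n : ℕ => (Part.some (Nat.unpair (Nat.unpair n).2).1 : Part ℕ) >>= charFn A :=
    .comp (.oracle _ rfl) (Nat.Partrec.recursiveIn (Partrec.nat_iff.1
      (Computable.fst.comp (Computable.unpair.comp (Computable.snd.comp Computable.unpair)))))
  have hi : Nat.RecursiveIn {charFn A} fun n : ℕ => (Part.some (Nat.unpair (Nat.unpair n).2).2 : Part ℕ) :=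
    Nat.Partrec.recursiveIn (Partrec.nat_iff.1
      (Computable.snd.comp (Computable.unpair.comp (Computable.snd.comp Computable.unpair))))
  have hadd : Nat.RecursiveIn {charFn A} fun n : ℕ => (Part.some ((Nat.unpair n).1 + (Nat.unpair n).2) : Part ℕ) :=
    Nat.Partrec.recursiveIn (Partrec.nat_iff.1 (Primrec.nat_add.comp (Primrec.fst.comp Primrec.unpair)
      (Primrec.snd.comp Primrec.unpair)).to_comp)
  have hp : Nat.RecursiveIn {charFn A} fun n : ℕ => (Part.some (Nat.pair 0 n) : Part ℕ) :=
    Nat.Partrec.recursiveIn (Partrec.nat_iff.1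
      (Primrec₂.natPair.comp (Primrec.const 0) Primrec.id).to_comp)
  refine (Nat.RecursiveIn.comp (Nat.RecursiveIn.prec hz (.comp hadd (.pair hi hχ))) hp).of_eq fun u => ?_
  simp only [Part.bind_eq_bind, Part.bind_some, Nat.unpair_pair]
  induction u with
  | zero => rfl
  | succ u ih =>
    simp only [] at ih ⊢
    rw [ih, Nat.count_succ]
    have hu : (Part.some u >>= charFn A) = Part.some (if u ∈ A then 1 else 0) :=
      (Part.bind_some u (charFn A)).trans (by simp [charFn])
    rw [hu]
    simp [Seq.seq]

theorem _root_.Computable.recursiveIn_some {O : Set (ℕ →. ℕ)} {f : ℕ → ℕ} (hf : Computable f) :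
    Nat.RecursiveIn O fun n => Part.some (f n) :=
  Nat.Partrec.recursiveIn (Partrec.nat_iff.1 hf)

theorem recursiveIn_rfind_count (A : Set ℕ) [DecidablePred (· ∈ A)] {K : ℕ → ℕ → ℕ → ℕ → Bool}
    (hK : Computable fun a : (ℕ × ℕ) × (ℕ × ℕ) => K a.1.1 a.1.2 a.2.1 a.2.2) :
    Nat.RecursiveIn {charFn A} fun n => Nat.rfind fun w =>
      Part.some (K n w.unpair.1 w.unpair.2 (Nat.count (· ∈ A) w.unpair.2)) := by
  have hu : Computable fun m : ℕ => m.unpair.2.unpair.2 :=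
    Computable.snd.comp (Computable.unpair.comp (Computable.snd.comp Computable.unpair))
  have c1 : Computable fun m : ℕ => m.unpair.1.unpair :=
    Computable.unpair.comp (Computable.fst.comp Computable.unpair)
  have c2 : Computable fun m : ℕ => m.unpair.1.unpair.2.unpair :=
    Computable.unpair.comp (Computable.snd.comp c1)
  have hk : Computable fun m : ℕ =>
      bif K m.unpair.1.unpair.1 m.unpair.1.unpair.2.unpair.1 m.unpair.1.unpair.2.unpair.2
        m.unpair.2 then 0 else 1 := by
    have h := hK.comp (((Computable.fst.comp c1).pair (Computable.fst.comp c2)).pair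
        ((Computable.snd.comp c2).pair (Computable.snd.comp Computable.unpair)))
    exact Computable.cond h (Computable.const 0) (Computable.const 1)
  have H := Nat.RecursiveIn.rfind (.comp hk.recursiveIn_some
    (.pair Computable.id.recursiveIn_some (.comp (recursiveIn_count A) hu.recursiveIn_some)))
  refine H.of_eq fun n => ?_
  congr 1
  funext w
  have h1 : ((Part.some (Nat.pair n w).unpair.2.unpair.2 : Part ℕ) >>=
      fun u => Part.some (Nat.count (· ∈ A) u)) = Part.some (Nat.count (· ∈ A) w.unpair.2) := by
    rw [Nat.unpair_pair]
    exact Part.bind_some _ _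
  rw [h1]
  simp only [Seq.seq, Part.map_eq_map, Part.map_some, Part.bind_eq_bind, Part.bind_some,
    Nat.unpair_pair, id]
  congr 1
  cases K n w.unpair.1 w.unpair.2 (Nat.count (· ∈ A) w.unpair.2) <;> rfl

theorem rfind_some_dom {P : ℕ → Bool} :
    (Nat.rfind fun s => Part.some (P s)).Dom ↔ ∃ s, P s = true := by
  refine Nat.rfind_dom.trans ?_
  simp only [Part.mem_some_iff, Part.some_dom, implies_true, and_true, eq_comm]

theorem exists_settling_bound {A B : Set ℕ} {cA cB : Code}
    (hcA : ∀ x, x ∈ A ↔ ∃ s, stageMem cA s x = true)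
    (hcB : ∀ x, x ∈ B ↔ ∃ s, stageMem cB s x = true)
    {f : ℕ → ℕ} (hf : Computable f) (hfA : ∀ e, W e ⊆ Aᶜ → (W e).encard ≤ (f e : ℕ∞)) :
    ∃ N : ℕ → ℕ, Computable N ∧ ∀ n t u, (∀ x < u, stageMem cA t x = true ↔ x ∈ A) →
      N n ≤ Nat.count (fun x => stageMem cA t x = false) u → (n ∈ B ↔ stageMem cB t n = true) := by
  -- On the input coding `(n, x)`, the search looks for the stage at which `n` enters `B` and asks
  -- whether `x` is then among the first `f e + 1` numbers outside `A`, where `e` is the index of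
  -- `curry c n`. The fixed point makes `c` compute `F c`, so that `e` is an index of this very set.
  let F : Code → ℕ →. ℕ := fun c m => Nat.rfind fun s => Part.some
    (stageMem cB (s + 1) m.unpair.1 && !stageMem cB s m.unpair.1 &&
      (!stageMem cA (s + 1) m.unpair.2 &&
        decide (Nat.count (fun x => (!stageMem cA (s + 1) x) = true) m.unpair.2
          < f (Encodable.encode (curry c m.unpair.1)) + 1)))
  have hF : Partrec₂ F := by
    have hs : Primrec fun a : (Code × ℕ) × ℕ => a.2 := Primrec.snd
    have hm : Primrec fun a : (Code × ℕ) × ℕ => a.1.2.unpair :=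
      Primrec.unpair.comp (Primrec.snd.comp Primrec.fst)
    have h1 : Primrec fun a : (Code × ℕ) × ℕ => stageMem cB (a.2 + 1) a.1.2.unpair.1 :=
      primrec_stageMem.comp (((Primrec.succ.comp hs).pair (Primrec.const cB)).pair
        (Primrec.fst.comp hm))
    have h2 : Primrec fun a : (Code × ℕ) × ℕ => stageMem cB a.2 a.1.2.unpair.1 :=
      primrec_stageMem.comp ((hs.pair (Primrec.const cB)).pair (Primrec.fst.comp hm))
    have h3 : Primrec fun a : (Code × ℕ) × ℕ => stageMem cA (a.2 + 1) a.1.2.unpair.2 :=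
      primrec_stageMem.comp (((Primrec.succ.comp hs).pair (Primrec.const cA)).pair
        (Primrec.snd.comp hm))
    have h4 : Primrec₂ fun (a : (Code × ℕ) × ℕ) (x : ℕ) => !stageMem cA (a.2 + 1) x :=
      Primrec.not.comp (primrec_stageMem.comp
        (((Primrec.succ.comp (hs.comp Primrec.fst)).pair (Primrec.const cA)).pair Primrec.snd))
    have h5 : Computable fun a : (Code × ℕ) × ℕ =>
        f (Encodable.encode (curry a.1.1 a.1.2.unpair.1)) + 1 :=
      Computable.succ.comp (hf.comp (Computable.encode.comp
        (Nat.Partrec.Code.primrec₂_curry.comp (Primrec.fst.comp Primrec.fst)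
          (Primrec.fst.comp hm)).to_comp))
    have h6 := (PrimrecRel.decide Primrec.nat_lt).to_comp.comp
      (primrec_count h4 (Primrec.snd.comp hm)).to_comp h5
    exact Partrec.rfind (Computable.partrec (Primrec.and.to_comp.comp
      (Primrec.and.comp h1 (Primrec.not.comp h2)).to_comp
      (Primrec.and.to_comp.comp (Primrec.not.comp h3).to_comp h6)))
  obtain ⟨c, hc⟩ := Code.fixed_point₂ hF
  refine ⟨fun n => f (Encodable.encode (curry c n)) + 1, ?_, fun n t u htu hN => ?_⟩
  · exact Computable.succ.comp (hf.comp (Computable.encode.comp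
      (Nat.Partrec.Code.primrec₂_curry.to_comp.comp (Computable.const c) Computable.id)))
  refine ⟨fun hn => ?_, fun h => (hcB n).2 ⟨t, h⟩⟩
  by_contra hnt
  -- Stage `0` accepts nothing, so the first stage accepting `n` is a successor.
  obtain ⟨s, hs, hs'⟩ : ∃ s, stageMem cB (s + 1) n = true ∧ stageMem cB s n = false := by
    have h := (hcB n).1 hn
    classical
    have h1 := Nat.find_spec h
    have h0 : Nat.find h ≠ 0 := fun h0 => by
      rw [h0] at h1
      exact absurd (stageMem_lt h1) (by simp)
    refine ⟨Nat.find h - 1, ?_, ?_⟩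
    · rwa [Nat.sub_add_cancel (Nat.pos_of_ne_zero h0)]
    · simpa using Nat.find_min h (show Nat.find h - 1 < Nat.find h by omega)
  have hts : t ≤ s := by
    by_contra h
    exact hnt (stageMem_mono (by omega) hs)
  have hW : ∀ x, x ∈ W (Encodable.encode (curry c n)) ↔ stageMem cA (s + 1) x = false ∧
      Nat.count (fun x => stageMem cA (s + 1) x = false) x
        < f (Encodable.encode (curry c n)) + 1 := by
    intro x
    simp only [W, Set.mem_ofPred_eq, Denumerable.ofNat_encode, Nat.Partrec.Code.eval_curry, hc]
    simp only [F, Nat.unpair_pair, rfind_some_dom, Bool.not_eq_true', Bool.and_eq_true,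
      decide_eq_true_eq]
    constructor
    · rintro ⟨s', ⟨h1, h2⟩, h3⟩
      have : s' = s := by
        rcases lt_trichotomy s' s with h | h | h
        · rw [stageMem_mono (show s' + 1 ≤ s from h) h1] at hs'
          cases hs'
        · exact h
        · rw [stageMem_mono (show s + 1 ≤ s' from h) hs] at h2
          cases h2
      exact this ▸ h3
    · intro h
      exact ⟨s, ⟨hs, hs'⟩, h⟩
  have hmem : ∀ x < u, stageMem cA (s + 1) x = false ↔ x ∉ A := by
    intro x hx
    rw [← htu x hx, ← not_iff_not]
    simp only [Bool.not_eq_false, not_not]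
    exact ⟨fun h => (htu x hx).2 ((hcA x).2 ⟨_, h⟩), stageMem_mono (by omega)⟩
  have hcount : Nat.count (fun x => stageMem cA (s + 1) x = false) u =
      Nat.count (fun x => stageMem cA t x = false) u := by
    rw [Nat.count_eq_card_filter_range, Nat.count_eq_card_filter_range]
    congr 1
    refine Finset.filter_congr fun x hx => ?_
    rw [hmem x (Finset.mem_range.1 hx), ← htu x (Finset.mem_range.1 hx)]
    simp
  -- There are already `f e + 1` nonmembers below `u`, so all listed numbers lie below `u`, where
  -- the stage is correct about `A`.
  have hsub : W (Encodable.encode (curry c n)) ⊆ Aᶜ := by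
    intro x hx
    obtain ⟨h1, h2⟩ := (hW x).1 hx
    refine (hmem x ?_).1 h1
    by_contra hux
    have := Nat.count_monotone (fun x => stageMem cA (s + 1) x = false) (not_lt.1 hux)
    simp only [] at hN
    omega
  -- A stage accepts only numbers below itself, so the list does reach `f e + 1` elements and
  -- contradicts `hfA`.
  have hinf : {x | stageMem cA (s + 1) x = false}.Infinite :=
    Set.infinite_of_forall_exists_gt fun a => ⟨s + 1 + (a + 1), by
      by_contra h
      rw [Set.mem_ofPred_eq, Bool.not_eq_false] at h
      have := stageMem_lt h
      omega, by omega⟩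
  have hle := hfA _ hsub
  have hsup : Nat.nth (fun x => stageMem cA (s + 1) x = false) ''
      (Finset.range (f (Encodable.encode (curry c n)) + 1) : Set ℕ) ⊆
      W (Encodable.encode (curry c n)) := by
    rintro _ ⟨i, hi, rfl⟩
    refine (hW _).2 ⟨Nat.nth_mem_of_infinite hinf i, ?_⟩
    rw [Nat.count_nth_of_infinite hinf]
    simpa using hi
  have := (Set.encard_le_encard hsup).trans hle
  rw [(Nat.nth_injective hinf).encard_image, Set.encard_coe_eq_coe_finsetCard,
    Finset.card_range] at this
  have := Nat.cast_le.1 this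
  omega

theorem EffectivelySimple.tComplete {A : Set ℕ} (hA : EffectivelySimple A) : TComplete A := by
  obtain ⟨hre, hinf, f, hf, hfA⟩ := hA
  refine ⟨hre, fun B hB => ?_⟩
  classical
  obtain ⟨cA, hcA⟩ := exists_code_of_rePred hre
  obtain ⟨cB, hcB⟩ := exists_code_of_rePred hB
  obtain ⟨N, hN, hNB⟩ := exists_settling_bound hcA hcB hf hfA
  -- The argument `a` is the true count of `A` below `u`: the test asks that stage `t` be correct
  -- below `u` and that at least `N n` nonmembers lie there.
  let K : ℕ → ℕ → ℕ → ℕ → Bool := fun n t u a =>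
    decide (a = Nat.count (fun x => stageMem cA t x = true) u) && decide (N n + a ≤ u)
  have hK : Computable fun a : (ℕ × ℕ) × (ℕ × ℕ) => K a.1.1 a.1.2 a.2.1 a.2.2 := by
    have h4 : Primrec₂ fun (a : (ℕ × ℕ) × (ℕ × ℕ)) (x : ℕ) => stageMem cA a.1.2 x :=
      primrec_stageMem.comp
        (((Primrec.snd.comp (Primrec.fst.comp Primrec.fst)).pair (Primrec.const cA)).pair
          Primrec.snd)
    have h5 : Primrec fun a : (ℕ × ℕ) × (ℕ × ℕ) => a.2.2 := Primrec.snd.comp Primrec.snd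
    have h6 : Primrec fun a : (ℕ × ℕ) × (ℕ × ℕ) => a.2.1 := Primrec.fst.comp Primrec.snd
    exact Primrec.and.to_comp.comp
      (Primrec.eq.decide.comp h5 (primrec_count h4 h6)).to_comp
      (Primrec.nat_le.decide.to_comp.comp (Primrec.nat_add.to_comp.comp
        (hN.comp (Computable.fst.comp Computable.fst)) h5.to_comp) h6.to_comp)
  have hcomp : ∀ (t u : ℕ), Nat.count (fun x => stageMem cA t x = true) u +
      Nat.count (fun x => stageMem cA t x = false) u = u := by
    intro t u
    induction u with
    | zero => rfl
    | succ u ih =>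
      rw [Nat.count_succ, Nat.count_succ]
      cases stageMem cA t u <;> simp <;> omega
  have hsub : ∀ t x, stageMem cA t x = true → x ∈ A := fun t x h => (hcA x).2 ⟨t, h⟩
  have hpost : Computable fun m : ℕ => bif stageMem cB m.unpair.2.unpair.1 m.unpair.1
      then 1 else 0 :=
    (Primrec.cond (primrec_stageMem.comp (((Primrec.fst.comp (Primrec.unpair.comp
      (Primrec.snd.comp Primrec.unpair))).pair (Primrec.const cB)).pair
        (Primrec.fst.comp Primrec.unpair))) (Primrec.const 1) (Primrec.const 0)).to_comp
  refine RecursiveIn.iff_nat.2 ((Nat.RecursiveIn.comp hpost.recursiveIn_some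
    (.pair Computable.id.recursiveIn_some (recursiveIn_rfind_count A hK))).of_eq fun n => ?_)
  obtain ⟨u, hu⟩ : ∃ u, N n ≤ Nat.count (· ∉ A) u :=
    ⟨Nat.nth (· ∉ A) (N n), (Nat.count_nth_of_infinite hinf _).ge⟩
  obtain ⟨t, ht⟩ := exists_stage_bound hcA u
  have hdom : (Nat.rfind fun w => Part.some
      (K n w.unpair.1 w.unpair.2 (Nat.count (· ∈ A) w.unpair.2))).Dom := by
    refine rfind_some_dom.2 ⟨Nat.pair t u, ?_⟩
    have h1 : Nat.count (· ∈ A) u = Nat.count (fun x => stageMem cA t x = true) u := by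
      rw [Nat.count_eq_card_filter_range, Nat.count_eq_card_filter_range]
      congr 1
      exact Finset.filter_congr fun x hx => (ht x (Finset.mem_range.1 hx)).symm
    have h2 : Nat.count (· ∉ A) u = Nat.count (fun x => stageMem cA t x = false) u := by
      rw [Nat.count_eq_card_filter_range, Nat.count_eq_card_filter_range]
      congr 1
      refine Finset.filter_congr fun x hx => ?_
      rw [← ht x (Finset.mem_range.1 hx)]
      simp
    have := hcomp t u
    simp only [K, Nat.unpair_pair, Bool.and_eq_true, decide_eq_true_eq]
    exact ⟨h1, by omega⟩
  obtain ⟨w, hw⟩ := Part.dom_iff_mem.1 hdom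
  have hKw := Nat.rfind_spec hw
  simp only [K, Part.mem_some_iff, Bool.true_eq, Bool.and_eq_true, decide_eq_true_eq] at hKw
  have hiff := hNB n w.unpair.1 w.unpair.2
    (fun x hx => ⟨hsub _ x, mem_of_count_eq (hsub _) hKw.1.symm hx⟩) (by
      have := hcomp w.unpair.1 w.unpair.2
      omega)
  rw [Part.eq_some_iff.2 hw]
  simp only [Seq.seq, Part.map_eq_map, Part.map_some, Part.bind_eq_bind, Part.bind_some,
    Nat.unpair_pair, id, charFn]
  congr 1
  by_cases hn : n ∈ B
  · simp [hiff.1 hn, hn]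
  · have : stageMem cB w.unpair.1 n = false := by
      simpa using fun h => hn (hiff.2 h)
    simp [hn, this]

theorem EffectivelySimple.not_computablePred {A : Set ℕ} (hA : EffectivelySimple A) :
    ¬ ComputablePred fun n => n ∈ A := by
  intro h
  obtain ⟨-, hinf, f, -, hf⟩ := hA
  obtain ⟨c, hc⟩ := exists_code_of_rePred (A := Aᶜ) h.not.to_re
  have hW : W (Encodable.encode c) = Aᶜ := by
    ext x
    rw [hc x, exists_stageMem_iff]
    simp [W]
  have := hf (Encodable.encode c) hW.subset
  rw [hW, hinf.encard_eq] at this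
  exact absurd this (by simp)

/-! ### The list construction -/

section Construction

variable (fire : ℕ → Option (ℕ × ℕ))

/-- Number of attacks of level `k` before stage `s`. -/
def attacks (k s : ℕ) : ℕ := Nat.count (fun t => decide ((fire t).map Prod.fst = some k) = true) s

/-- An attack of level `k` on `x` lowers the priority bound of `x` to at most `k / 2`. -/
def attack (k x : ℕ) (L : List (ℕ × ℕ)) : List (ℕ × ℕ) :=
  L.map fun e => (e.1, bif decide (e.1 = x) then min e.2 (k / 2) else e.2)

/-- The end of a round of level `k`: past the first `k` entries, only those with bound at most `k`
survive, and all bounds become at most `k`. -/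
def purge (k : ℕ) (L : List (ℕ × ℕ)) : List (ℕ × ℕ) :=
  (L.take k ++ (L.drop k).filter fun e => decide (e.2 ≤ k)).map fun e => (e.1, min e.2 k)

/-- The action of stage `s`, where every `2 ^ k`-th attack of level `k` ends a round. -/
def act (s : ℕ) (L : List (ℕ × ℕ)) : List (ℕ × ℕ) :=
  (fire s).elim L fun a =>
    bif decide (attacks fire a.1 (s + 1) % 2 ^ a.1 = 0) then purge a.1 (attack a.1 a.2 L)
    else attack a.1 a.2 L

/-- The list of candidates for the complement, each with its priority bound, before stage `s`. -/
def live (s : ℕ) : List (ℕ × ℕ) :=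
  Nat.rec [] (fun t L => act fire t L ++ [(t, t)]) s

/-- The candidates before stage `s`. -/
def liveIds (s : ℕ) : List ℕ := (live fire s).map Prod.fst

/-- The set of the numbers that are eventually dropped from the list. -/
def dropped : Set ℕ := {x | ∃ s, x < s ∧ x ∉ liveIds fire s}

/-- Number of rounds of level `k` that end before stage `s`. -/
def rounds (k s : ℕ) : ℕ := attacks fire k s / 2 ^ k

/-- Number of rounds of level less than `h` that end before stage `s`. -/
def roundsBelow (h s : ℕ) : ℕ := ∑ k ∈ Finset.range h, rounds fire k s

theorem live_succ (s : ℕ) : live fire (s + 1) = act fire s (live fire s) ++ [(s, s)] := rfl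

variable {fire}

theorem map_fst_attack (k x : ℕ) (L : List (ℕ × ℕ)) :
    (attack k x L).map Prod.fst = L.map Prod.fst := by
  simp [attack, Function.comp_def]

theorem map_fst_purge_sublist (k : ℕ) (L : List (ℕ × ℕ)) :
    List.Sublist ((purge k L).map Prod.fst) (L.map Prod.fst) := by
  have h : (purge k L).map Prod.fst =
      (L.take k ++ (L.drop k).filter fun e => decide (e.2 ≤ k)).map Prod.fst := by
    simp [purge, Function.comp_def]
  rw [h]
  refine List.Sublist.map _ ?_
  conv_rhs => rw [← List.take_append_drop k L]
  exact List.Sublist.append (List.Sublist.refl _) List.filter_sublist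

theorem map_fst_act_sublist (s : ℕ) (L : List (ℕ × ℕ)) :
    List.Sublist ((act fire s L).map Prod.fst) (L.map Prod.fst) := by
  unfold act
  cases fire s with
  | none => exact List.Sublist.refl _
  | some a =>
    simp only [Option.elim_some]
    cases decide (attacks fire a.1 (s + 1) % 2 ^ a.1 = 0)
    · rw [cond_false, map_fst_attack]
    · exact (map_fst_purge_sublist _ _).trans (by rw [map_fst_attack])

theorem liveIds_succ (s : ℕ) :
    liveIds fire (s + 1) = (act fire s (live fire s)).map Prod.fst ++ [s] := by
  simp [liveIds, live_succ]

theorem lt_of_mem_liveIds {s x : ℕ} (h : x ∈ liveIds fire s) : x < s := by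
  induction s with
  | zero => simp [liveIds, live] at h
  | succ s ih =>
    rw [liveIds_succ, List.mem_append, List.mem_singleton] at h
    rcases h with h | rfl
    · exact (ih ((map_fst_act_sublist s _).subset h)).trans (Nat.lt_succ_self s)
    · exact Nat.lt_succ_self _

theorem nodup_liveIds (s : ℕ) : (liveIds fire s).Nodup := by
  induction s with
  | zero => simp [liveIds, live]
  | succ s ih =>
    rw [liveIds_succ, List.nodup_append]
    refine ⟨ih.sublist (map_fst_act_sublist s _), List.nodup_singleton s, ?_⟩
    intro x hx y hy
    have := lt_of_mem_liveIds ((map_fst_act_sublist s _).subset hx)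
    rw [List.mem_singleton] at hy
    omega

theorem mem_liveIds_of_le {s t x : ℕ} (hxs : x < s) (hst : s ≤ t) (h : x ∈ liveIds fire t) :
    x ∈ liveIds fire s := by
  induction t, hst using Nat.le_induction with
  | base => exact h
  | succ t hst ih =>
    rw [liveIds_succ, List.mem_append, List.mem_singleton] at h
    rcases h with h | rfl
    · exact ih ((map_fst_act_sublist t _).subset h)
    · omega

theorem attacks_succ (k s : ℕ) : attacks fire k (s + 1) =
    attacks fire k s + if (fire s).map Prod.fst = some k then 1 else 0 := by
  rw [attacks, Nat.count_succ]
  by_cases h : (fire s).map Prod.fst = some k <;> simp [h, attacks]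

theorem attacks_mono (k : ℕ) : Monotone (attacks fire k) := Nat.count_monotone _

theorem rounds_mono (k : ℕ) : Monotone (rounds fire k) :=
  fun _ _ h => Nat.div_le_div_right (attacks_mono k h)

/-- A round of level `k` ends at stage `s`. -/
theorem rounds_succ_of_attack {s k x : ℕ} (h : fire s = some (k, x))
    (hr : attacks fire k (s + 1) % 2 ^ k = 0) : rounds fire k s < rounds fire k (s + 1) := by
  have h1 : attacks fire k (s + 1) = attacks fire k s + 1 := by simp [attacks_succ, h]
  unfold rounds
  rw [h1] at hr ⊢
  rw [Nat.succ_div_of_mod_eq_zero hr]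
  exact Nat.lt_succ_self _

theorem exists_attack_of_rounds_lt {s k : ℕ} (h : rounds fire k s < rounds fire k (s + 1)) :
    ∃ x, fire s = some (k, x) ∧ attacks fire k (s + 1) % 2 ^ k = 0 := by
  unfold rounds at h
  rw [attacks_succ] at h ⊢
  split_ifs at h ⊢ with hk
  · obtain ⟨a, ha, rfl⟩ := Option.map_eq_some_iff.1 hk
    refine ⟨a.2, ha, ?_⟩
    by_contra hm
    rw [Nat.succ_div_of_mod_ne_zero hm] at h
    exact lt_irrefl _ h
  · exact absurd h (lt_irrefl _)

theorem exists_round_of_rounds_lt {s t k : ℕ} (hst : s ≤ t) (h : rounds fire k s < rounds fire k t) :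
    ∃ r x, s ≤ r ∧ r < t ∧ fire r = some (k, x) ∧ attacks fire k (r + 1) % 2 ^ k = 0 := by
  induction t, hst using Nat.le_induction with
  | base => exact absurd h (lt_irrefl _)
  | succ t hst ih =>
    by_cases ht : rounds fire k s < rounds fire k t
    · obtain ⟨r, x, h1, h2, h3⟩ := ih ht
      exact ⟨r, x, h1, h2.trans (Nat.lt_succ_self t), h3⟩
    · obtain ⟨x, hx⟩ := exists_attack_of_rounds_lt (show rounds fire k t < _ by omega)
      exact ⟨t, x, hst, Nat.lt_succ_self t, hx⟩

/-! #### The priority bounds -/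

theorem mem_act {s x q : ℕ} {L : List (ℕ × ℕ)} (h : (x, q) ∈ act fire s L) :
    ∃ p, (x, p) ∈ L ∧ q ≤ p := by
  have hatt : ∀ {k y q}, (x, q) ∈ attack k y L → ∃ p, (x, p) ∈ L ∧ q ≤ p := by
    intro k y q h
    obtain ⟨⟨z, p⟩, he, heq⟩ := List.mem_map.1 h
    obtain ⟨rfl, rfl⟩ := Prod.mk.inj heq
    refine ⟨p, he, ?_⟩
    cases decide (z = y) <;> simp
  unfold act at h
  cases hf : fire s with
  | none =>
    rw [hf] at h
    exact ⟨q, h, le_rfl⟩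
  | some a =>
    rw [hf] at h
    simp only [Option.elim_some] at h
    cases hd : decide (attacks fire a.1 (s + 1) % 2 ^ a.1 = 0)
    · rw [hd, cond_false] at h
      exact hatt h
    · rw [hd, cond_true] at h
      obtain ⟨⟨z, p⟩, he, heq⟩ := List.mem_map.1 h
      obtain ⟨rfl, rfl⟩ := Prod.mk.inj heq
      have he' : (z, p) ∈ attack a.1 a.2 L := by
        rcases List.mem_append.1 he with he | he
        · exact List.mem_of_mem_take he
        · exact List.mem_of_mem_drop (List.mem_filter.1 he).1
      obtain ⟨p', hp', hle⟩ := hatt he'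
      exact ⟨p', hp', (min_le_left _ _).trans hle⟩

/-- The number `x` is not a candidate before stage `s`, or its bound is at most `h`. -/
def Settled (fire : ℕ → Option (ℕ × ℕ)) (h s x : ℕ) : Prop := ∀ p, (x, p) ∈ live fire s → p ≤ h

theorem Settled.mono {h s t x : ℕ} (hxs : x < s) (hst : s ≤ t) (hx : Settled fire h s x) :
    Settled fire h t x := by
  induction t, hst using Nat.le_induction with
  | base => exact hx
  | succ t hst ih =>
    intro q hq
    rw [live_succ, List.mem_append, List.mem_singleton] at hq
    rcases hq with hq | hq
    · obtain ⟨p, hp, hle⟩ := mem_act hq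
      exact hle.trans (ih p hp)
    · have := (Prod.mk.inj hq).1
      omega

theorem settled_of_attack {s k x : ℕ} (hxs : x < s) (h : fire s = some (k, x)) :
    Settled fire (k / 2) (s + 1) x := by
  have hatt : ∀ {L q}, (x, q) ∈ attack k x L → q ≤ k / 2 := by
    intro L q h
    obtain ⟨⟨z, p⟩, he, heq⟩ := List.mem_map.1 h
    obtain ⟨rfl, rfl⟩ := Prod.mk.inj heq
    simp
  intro q hq
  rw [live_succ, List.mem_append, List.mem_singleton] at hq
  rcases hq with hq | hq
  · rw [act, h, Option.elim_some] at hq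
    cases hd : decide (attacks fire k (s + 1) % 2 ^ k = 0)
    · rw [hd, cond_false] at hq
      exact hatt hq
    · rw [hd, cond_true] at hq
      obtain ⟨⟨z, p⟩, he, heq⟩ := List.mem_map.1 hq
      obtain ⟨rfl, rfl⟩ := Prod.mk.inj heq
      refine (min_le_left _ _).trans ?_
      rcases List.mem_append.1 he with he | he
      · exact hatt (List.mem_of_mem_take he)
      · exact hatt (List.mem_of_mem_drop (List.mem_filter.1 he).1)
  · have := (Prod.mk.inj hq).1
    omega

theorem settled_of_round {s k y x : ℕ} (hxs : x < s) (h : fire s = some (k, y))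
    (hr : attacks fire k (s + 1) % 2 ^ k = 0) : Settled fire k (s + 1) x := by
  intro q hq
  rw [live_succ, List.mem_append, List.mem_singleton] at hq
  rcases hq with hq | hq
  · rw [act, h, Option.elim_some, decide_eq_true hr, cond_true] at hq
    obtain ⟨⟨z, p⟩, he, heq⟩ := List.mem_map.1 hq
    obtain ⟨rfl, rfl⟩ := Prod.mk.inj heq
    exact min_le_right _ _
  · have := (Prod.mk.inj hq).1
    omega

/-- An entry is only dropped at the end of a round of a level below its bound. -/
theorem mem_liveIds_succ {s h x p : ℕ} (hx : (x, p) ∈ live fire s) (hp : p ≤ h)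
    (hr : ∀ k < h, rounds fire k s = rounds fire k (s + 1)) : x ∈ liveIds fire (s + 1) := by
  have hatt : ∀ k y, ∃ q ≤ h, (x, q) ∈ attack k y (live fire s) := fun k y =>
    ⟨_, by cases decide (x = y) <;> simp [hp], List.mem_map.2 ⟨(x, p), hx, rfl⟩⟩
  rw [liveIds_succ, List.mem_append]
  refine Or.inl (List.mem_map.2 ?_)
  suffices ∃ q, (x, q) ∈ act fire s (live fire s) from this.elim fun q hq => ⟨_, hq, rfl⟩
  unfold act
  cases hf : fire s with
  | none => exact ⟨p, hx⟩
  | some a =>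
    obtain ⟨q, hq, hmem⟩ := hatt a.1 a.2
    rw [Option.elim_some]
    cases hd : decide (attacks fire a.1 (s + 1) % 2 ^ a.1 = 0)
    · exact ⟨q, hmem⟩
    · have hlt := rounds_succ_of_attack hf (of_decide_eq_true hd)
      have hle : h ≤ a.1 := by
        by_contra hlt'
        have := hr a.1 (not_le.1 hlt')
        omega
      rw [cond_true]
      refine ⟨_, List.mem_map.2 ⟨(x, q), ?_, rfl⟩⟩
      rw [← List.take_append_drop a.1 (attack a.1 a.2 (live fire s)), List.mem_append] at hmem
      rw [List.mem_append]
      refine hmem.imp_right fun hmem => List.mem_filter.2 ⟨hmem, ?_⟩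
      simpa using hq.trans hle

theorem mem_live_of_mem_liveIds {s x : ℕ} (h : x ∈ liveIds fire s) :
    ∃ p, (x, p) ∈ live fire s := by
  obtain ⟨⟨z, p⟩, he, rfl⟩ := List.mem_map.1 h
  exact ⟨p, he⟩

theorem mem_liveIds_of_mem_live {s x p : ℕ} (h : (x, p) ∈ live fire s) : x ∈ liveIds fire s :=
  List.mem_map.2 ⟨_, h, rfl⟩

/-- This makes the answer "not dropped" sound. The bound of `x` stays at most `h`, and only a round
of level below `h`, of which none is left, could drop it. -/
theorem notMem_dropped {s h x p : ℕ} (hx : (x, p) ∈ live fire s) (hp : p ≤ h)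
    (hr : ∀ t, s ≤ t → ∀ k < h, rounds fire k s = rounds fire k t) : x ∉ dropped fire := by
  have hxs : x < s := lt_of_mem_liveIds (mem_liveIds_of_mem_live hx)
  have hall : ∀ t, s ≤ t → ∃ p ≤ h, (x, p) ∈ live fire t := by
    intro t hst
    induction t, hst using Nat.le_induction with
    | base => exact ⟨p, hp, hx⟩
    | succ t hst ih =>
      obtain ⟨q, hq, hmem⟩ := ih
      obtain ⟨q', hq'⟩ := mem_live_of_mem_liveIds (mem_liveIds_succ hmem hq fun k hk =>
        (hr t hst k hk).symm.trans (hr (t + 1) (hst.trans (Nat.le_succ t)) k hk))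
      refine ⟨q', ?_, hq'⟩
      rw [live_succ, List.mem_append, List.mem_singleton] at hq'
      rcases hq' with hq' | hq'
      · have hset : Settled fire h t x := by
          refine Settled.mono hxs hst fun p' hp' => ?_
          have : p' = p := by
            have hnd := nodup_liveIds (fire := fire) s
            exact congrArg Prod.snd (List.inj_on_of_nodup_map hnd hp' hx rfl)
          omega
        obtain ⟨r, hr, hle⟩ := mem_act hq'
        exact hle.trans (hset r hr)
      · have := (Prod.mk.inj hq').1
        omega
  rintro ⟨t, hxt, hnot⟩
  rcases le_total s t with hst | hts
  · obtain ⟨q, -, hq⟩ := hall t hst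
    exact hnot (mem_liveIds_of_mem_live hq)
  · exact hnot (mem_liveIds_of_le hxt hts (mem_liveIds_of_mem_live hx))

/-! #### The complement is infinite -/

theorem take_map_fst_purge {k n : ℕ} (hnk : n ≤ k) (L : List (ℕ × ℕ)) :
    ((purge k L).map Prod.fst).take n = (L.map Prod.fst).take n := by
  have h : (purge k L).map Prod.fst =
      (L.take k ++ (L.drop k).filter fun e => decide (e.2 ≤ k)).map Prod.fst := by
    simp [purge, Function.comp_def]
  rw [h, ← List.map_take, ← List.map_take]
  congr 1
  rcases le_total k L.length with hk | hk
  · rw [List.take_append_of_le_length (by simp; omega), List.take_take, min_eq_left hnk]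
  · rw [List.drop_eq_nil_of_le hk, List.take_of_length_le hk]
    simp

theorem take_map_fst_act {s n : ℕ} (L : List (ℕ × ℕ))
    (hr : ∀ k < n, rounds fire k s = rounds fire k (s + 1)) :
    ((act fire s L).map Prod.fst).take n = (L.map Prod.fst).take n := by
  unfold act
  cases hf : fire s with
  | none => rfl
  | some a =>
    rw [Option.elim_some]
    cases hd : decide (attacks fire a.1 (s + 1) % 2 ^ a.1 = 0)
    · rw [cond_false, map_fst_attack]
    · have hlt := rounds_succ_of_attack hf (of_decide_eq_true hd)
      have hle : n ≤ a.1 := by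
        by_contra hlt'
        have := hr a.1 (not_le.1 hlt')
        omega
      rw [cond_true, take_map_fst_purge hle, map_fst_attack]

theorem exists_rounds_const {b : ℕ → ℕ} (hb : ∀ k s, attacks fire k s ≤ b k) (n : ℕ) :
    ∃ s₀, ∀ t, s₀ ≤ t → ∀ k < n, attacks fire k t = attacks fire k s₀ := by
  induction n with
  | zero => exact ⟨0, by simp⟩
  | succ n ih =>
    obtain ⟨s₀, hs₀⟩ := ih
    have hbdd : BddAbove (Set.range (attacks fire n)) := ⟨b n, by rintro _ ⟨s, rfl⟩; exact hb n s⟩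
    obtain ⟨s₁, hs₁⟩ := Nat.sSup_mem (Set.range_nonempty _) hbdd
    refine ⟨max s₀ s₁, fun t ht k hk => ?_⟩
    rcases Nat.lt_succ_iff_lt_or_eq.1 hk with hk | rfl
    · rw [hs₀ t (le_of_max_le_left ht) k hk, hs₀ _ (le_max_left _ _) k hk]
    · have h : ∀ t, s₁ ≤ t → attacks fire k t = attacks fire k s₁ := fun t ht =>
        le_antisymm (hs₁ ▸ le_csSup hbdd ⟨t, rfl⟩) (attacks_mono k ht)
      rw [h t (le_of_max_le_right ht), h _ (le_max_right _ _)]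

/-- Once the rounds of level below `n` are over, the first `n` entries are never touched. Every
stage appends a number, so the list reaches length `n`, and its first `n` entries then stay forever.
-/
theorem infinite_compl_dropped {b : ℕ → ℕ} (hb : ∀ k s, attacks fire k s ≤ b k) :
    (dropped fire)ᶜ.Infinite := by
  intro hfin
  obtain ⟨n, hn⟩ : ∃ n, hfin.toFinset.card < n := ⟨_, Nat.lt_succ_self _⟩
  obtain ⟨s₀, hs₀⟩ := exists_rounds_const hb n
  have hr : ∀ t, s₀ ≤ t → ∀ k < n, rounds fire k t = rounds fire k (t + 1) := fun t ht k hk => by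
    rw [rounds, rounds, hs₀ t ht k hk, hs₀ (t + 1) (by omega) k hk]
  have htake : ∀ t, s₀ ≤ t → ((act fire t (live fire t)).map Prod.fst).take n =
      (liveIds fire t).take n := fun t ht => take_map_fst_act _ (hr t ht)
  have hlen : ∀ i, i ≤ n → i ≤ (liveIds fire (s₀ + i)).length := by
    intro i
    induction i with
    | zero => simp
    | succ i ih =>
      intro hi
      have h := congrArg List.length (htake (s₀ + i) (by omega))
      have := ih (by omega)
      rw [List.length_take, List.length_take] at h
      rw [← Nat.add_assoc, liveIds_succ, List.length_append, List.length_singleton]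
      omega
  have hconst : ∀ t, s₀ + n ≤ t → n ≤ (liveIds fire t).length ∧
      (liveIds fire t).take n = (liveIds fire (s₀ + n)).take n := by
    intro t ht
    induction t, ht using Nat.le_induction with
    | base => exact ⟨hlen n le_rfl, rfl⟩
    | succ t ht ih =>
      have h := htake t (by omega)
      have h' := congrArg List.length h
      rw [List.length_take, List.length_take] at h'
      rw [liveIds_succ, List.length_append, List.take_append_of_le_length (by omega), h]
      exact ⟨by omega, ih.2⟩
  have hsub : ((liveIds fire (s₀ + n)).take n).toFinset ⊆ hfin.toFinset := by
    intro x hx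
    rw [List.mem_toFinset] at hx
    rw [Set.Finite.mem_toFinset]
    rintro ⟨t, hxt, hnot⟩
    refine hnot (mem_liveIds_of_le hxt (le_max_left t (s₀ + n)) ?_)
    refine List.mem_of_mem_take (i := n) ?_
    rwa [(hconst _ (le_max_right _ _)).2]
  have hcard := Finset.card_le_card hsub
  rw [List.toFinset_card_of_nodup ((nodup_liveIds _).sublist (List.take_sublist _ _)),
    List.length_take] at hcard
  have := hlen n le_rfl
  omega

/-! #### Few entries have small bounds -/

/-- Number of attacks of level less than `m` before stage `s`. -/
def attacksBelow (fire : ℕ → Option (ℕ × ℕ)) (m s : ℕ) : ℕ :=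
  ∑ k ∈ Finset.range m, attacks fire k s

theorem attacksBelow_succ_of_lt {s k x m : ℕ} (h : fire s = some (k, x)) (hk : k < m) :
    attacksBelow fire m (s + 1) = attacksBelow fire m s + 1 := by
  simp [attacksBelow, attacks_succ, h, Finset.sum_add_distrib, hk]

theorem attacksBelow_mono (m : ℕ) : Monotone (attacksBelow fire m) :=
  fun _ _ h => Finset.sum_le_sum fun k _ => attacks_mono k h

theorem countP_attack_le {k l x : ℕ} {L : List (ℕ × ℕ)} (hL : (L.map Prod.fst).Nodup) :
    (attack l x L).countP (fun e => decide (e.2 ≤ k)) ≤ L.countP (fun e => decide (e.2 ≤ k)) + 1 := by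
  induction L with
  | nil => simp [attack]
  | cons e L ih =>
    rw [List.map_cons, List.nodup_cons] at hL
    have hc : attack l x (e :: L) =
      (e.1, bif decide (e.1 = x) then min e.2 (l / 2) else e.2) :: attack l x L := rfl
    by_cases he : e.1 = x
    · have hsame : attack l x L = L := by
        refine (List.map_congr_left fun a ha => ?_).trans (List.map_id L)
        have : a.1 ≠ x := fun h => hL.1 (he ▸ h ▸ List.mem_map.2 ⟨a, ha, rfl⟩)
        simp [this]
      rw [hc, hsame, List.countP_cons, List.countP_cons]
      split_ifs <;> omega
    · have := ih hL.2
      rw [hc, List.countP_cons, List.countP_cons]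
      simp only [he, decide_false, cond_false]
      omega

theorem countP_attack_of_lt {k l x : ℕ} {L : List (ℕ × ℕ)} (hl : k < l / 2) :
    (attack l x L).countP (fun e => decide (e.2 ≤ k)) = L.countP (fun e => decide (e.2 ≤ k)) := by
  rw [attack, List.countP_map]
  refine List.countP_congr fun e _ => ?_
  by_cases he : e.1 = x <;> simp [he]
  omega

/-- For `l ≤ k` the extra `k` pays for the first `l` entries, whose bounds are lowered
unconditionally; the other survivors had bound at most `l` before. For `l > k` no bound falls to `k`
or below. -/
theorem countP_purge_le {k l : ℕ} {L : List (ℕ × ℕ)} :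
    (purge l L).countP (fun e => decide (e.2 ≤ k)) ≤
      L.countP (fun e => decide (e.2 ≤ k)) + if l ≤ k then k else 0 := by
  rw [purge, List.countP_map, List.countP_append]
  conv_rhs => rw [← List.take_append_drop l L, List.countP_append]
  split_ifs with hl
  · have h1 := List.countP_le_length (l := L.take l) (p := (fun e => decide (e.2 ≤ k)) ∘ fun e : ℕ × ℕ => (e.1, min e.2 l))
    have h2 : ((L.drop l).filter fun e => decide (e.2 ≤ l)).countP
        ((fun e => decide (e.2 ≤ k)) ∘ fun e : ℕ × ℕ => (e.1, min e.2 l)) ≤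
        (L.drop l).countP (fun e => decide (e.2 ≤ k)) := by
      rw [List.countP_filter]
      refine List.countP_mono_left fun e _ he => ?_
      simp at he ⊢
      omega
    rw [List.length_take] at h1
    omega
  · have h0 : ((fun e => decide (e.2 ≤ k)) ∘ fun e : ℕ × ℕ => (e.1, min e.2 l)) =
        fun e => decide (e.2 ≤ k) := by
      funext e
      simp
      omega
    rw [h0]
    have := List.Sublist.countP_le (p := fun e : ℕ × ℕ => decide (e.2 ≤ k))
      (List.filter_sublist (l := L.drop l) (p := fun e => decide (e.2 ≤ l)))
    omega

/-- Entries born with bound at most `k` have number at most `k`, which gives the first term. After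
that only attacks of level below `2 * k + 2` matter, since `l / 2 ≤ k` is needed: each contributes
at most one entry, and at most `k` more if it ends a round of level at most `k`. -/
theorem countP_live_le (k s : ℕ) : (live fire s).countP (fun e => decide (e.2 ≤ k)) ≤
    min s (k + 1) + (k + 1) * attacksBelow fire (2 * k + 2) s := by
  induction s with
  | zero => simp [live]
  | succ s ih =>
    have hlast : [(s, s)].countP (fun e => decide (e.2 ≤ k)) + min s (k + 1) =
        min (s + 1) (k + 1) := by
      rw [List.countP_singleton]
      split_ifs with h <;> simp at h <;> omega
    have hact : (act fire s (live fire s)).countP (fun e => decide (e.2 ≤ k)) +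
        (k + 1) * attacksBelow fire (2 * k + 2) s ≤
        (live fire s).countP (fun e => decide (e.2 ≤ k)) +
          (k + 1) * attacksBelow fire (2 * k + 2) (s + 1) := by
      have hmono := Nat.mul_le_mul_left (k + 1)
        (attacksBelow_mono (fire := fire) (2 * k + 2) (Nat.le_add_right s 1))
      unfold act
      cases hf : fire s with
      | none =>
        rw [Option.elim_none]
        exact Nat.add_le_add_left hmono _
      | some a =>
        rw [Option.elim_some]
        have hp := countP_purge_le (k := k) (l := a.1) (L := attack a.1 a.2 (live fire s))
        by_cases ha : a.1 < 2 * k + 2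
        · have h1 := countP_attack_le (k := k) (l := a.1) (x := a.2) (nodup_liveIds (fire := fire) s)
          rw [attacksBelow_succ_of_lt hf ha, Nat.mul_add, Nat.mul_one]
          cases decide (attacks fire a.1 (s + 1) % 2 ^ a.1 = 0)
          · rw [cond_false]; omega
          · rw [cond_true]; split_ifs at hp <;> omega
        · have h1 := countP_attack_of_lt (k := k) (l := a.1) (x := a.2) (L := live fire s) (by omega)
          rw [if_neg (by omega)] at hp
          cases decide (attacks fire a.1 (s + 1) % 2 ^ a.1 = 0)
          · rw [cond_false]; omega
          · rw [cond_true]; omega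
    rw [live_succ, List.countP_append]
    omega

theorem attacksBelow_le (hb : ∀ k s, attacks fire k s ≤ 8 ^ k) (m s : ℕ) :
    attacksBelow fire m s ≤ 8 ^ m := by
  induction m with
  | zero => simp [attacksBelow]
  | succ m ih =>
    rw [attacksBelow, Finset.sum_range_succ]
    have := hb m s
    rw [attacksBelow] at ih
    rw [pow_succ]
    omega

/-- Bound for the number of entries of bound at most `k`. -/
def entryBound (k : ℕ) : ℕ := k + 1 + (k + 1) * 8 ^ (2 * k + 2)

/-- Among sufficiently many numbers below `u`, one is dropped if enough attacks of level `k` take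
place after stage `u`. -/
theorem exists_mem_dropped (hb : ∀ k s, attacks fire k s ≤ 8 ^ k) {k u t : ℕ}
    (hut : u ≤ t) (hatt : attacks fire k u + 2 ^ k ≤ attacks fire k t) {S : Finset ℕ}
    (hS : ∀ x ∈ S, x < u) (hcard : entryBound k < S.card) : ∃ x ∈ S, x ∈ dropped fire := by
  -- Any `2 ^ k` consecutive attacks of level `k` contain the end of a round.
  have hlt : rounds fire k u < rounds fire k t := by
    rw [rounds, rounds, Nat.lt_iff_add_one_le, ← Nat.add_div_right _ (by positivity)]
    exact Nat.div_le_div_right hatt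
  obtain ⟨r, y, hur, -, hf, hr⟩ := exists_round_of_rounds_lt hut hlt
  -- If all of `S` survived that round, every element would have bound at most `k` right after it,
  -- which is more than `entryBound k` allows.
  by_contra! hcon
  have halive : ∀ x ∈ S, x ∈ liveIds fire (r + 1) := by
    intro x hx
    by_contra h
    exact hcon x hx ⟨r + 1, by have := hS x hx; omega, h⟩
  have hsub : S ⊆ (((live fire (r + 1)).filter fun e => decide (e.2 ≤ k)).map Prod.fst).toFinset := by
    intro x hx
    obtain ⟨p, hp⟩ := mem_live_of_mem_liveIds (halive x hx)
    have hle := settled_of_round (lt_of_lt_of_le (hS x hx) hur) hf hr p hp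
    rw [List.mem_toFinset]
    exact List.mem_map.2 ⟨(x, p), List.mem_filter.2 ⟨hp, by simpa using hle⟩, rfl⟩
  have h1 := (Finset.card_le_card hsub).trans (List.toFinset_card_le _)
  rw [List.length_map, ← List.countP_eq_length_filter] at h1
  have h2 := countP_live_le (fire := fire) k (r + 1)
  have h3 := Nat.mul_le_mul_left (k + 1) (attacksBelow_le hb (2 * k + 2) (r + 1))
  unfold entryBound at hcard
  omega

end Construction

/-! ### Computability of the construction -/

theorem primrec_filter {α β : Type*} [Primcodable α] [Primcodable β] {f : α → List β}
    {p : α → β → Bool} (hf : Primrec f) (hp : Primrec₂ p) :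
    Primrec fun a => (f a).filter (p a) := by
  have h : Primrec₂ fun (a : α) (b : β) => bif p a b then some b else none :=
    Primrec.cond hp (Primrec.option_some.comp Primrec.snd) (Primrec.const none)
  refine (Primrec.listFilterMap hf h).of_eq fun a => ?_
  rw [← List.filterMap_eq_filter]
  congr 1
  funext b
  cases hb : p a b <;> simp [Option.guard, hb]

theorem primrec_sum_range {α : Type*} [Primcodable α] {g : α → ℕ → ℕ} (hg : Primrec₂ g)
    {f : α → ℕ} (hf : Primrec f) : Primrec fun a => ∑ k ∈ Finset.range (f a), g a k := by
  have h : Primrec₂ fun (a : α) (r : ℕ × ℕ) => r.2 + g a r.1 :=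
    Primrec.nat_add.comp (Primrec.snd.comp Primrec.snd)
      (hg.comp Primrec.fst (Primrec.fst.comp Primrec.snd))
  refine (Primrec.nat_rec' hf (Primrec.const 0) h).of_eq fun a => ?_
  induction f a with
  | zero => rfl
  | succ n ih =>
    rw [Finset.sum_range_succ, ← ih]

theorem primrec_attack :
    Primrec fun a : (ℕ × ℕ) × List (ℕ × ℕ) => attack a.1.1 a.1.2 a.2 := by
  have he : Primrec fun b : ((ℕ × ℕ) × List (ℕ × ℕ)) × (ℕ × ℕ) => b.2 := Primrec.snd
  have ha : Primrec fun b : ((ℕ × ℕ) × List (ℕ × ℕ)) × (ℕ × ℕ) => b.1.1 :=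
    Primrec.fst.comp Primrec.fst
  exact Primrec.list_map Primrec.snd ((Primrec.fst.comp he).pair
    (Primrec.cond (Primrec.eq.decide.comp (Primrec.fst.comp he) (Primrec.snd.comp ha))
      (Primrec.nat_min.comp (Primrec.snd.comp he)
        (Primrec.nat_div.comp (Primrec.fst.comp ha) (Primrec.const 2)))
      (Primrec.snd.comp he)))

theorem primrec_purge : Primrec fun a : ℕ × List (ℕ × ℕ) => purge a.1 a.2 := by
  have hf : Primrec fun a : ℕ × List (ℕ × ℕ) =>
      (a.2.drop a.1).filter fun e => decide (e.2 ≤ a.1) :=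
    primrec_filter (p := fun (a : ℕ × List (ℕ × ℕ)) (e : ℕ × ℕ) => decide (e.2 ≤ a.1))
      (Primrec.list_drop.comp Primrec.fst Primrec.snd)
      (Primrec.nat_le.decide.comp (Primrec.snd.comp Primrec.snd) (Primrec.fst.comp Primrec.fst))
  exact Primrec.list_map
    (Primrec.list_append.comp (Primrec.list_take.comp Primrec.fst Primrec.snd) hf)
    ((Primrec.fst.comp Primrec.snd).pair
      (Primrec.nat_min.comp (Primrec.snd.comp Primrec.snd) (Primrec.fst.comp Primrec.fst)))

section Construction

variable {fire : ℕ → Option (ℕ × ℕ)}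

theorem primrec_attacks (hfire : Primrec fire) : Primrec₂ (attacks fire) := by
  have h : Primrec₂ fun (a : ℕ × ℕ) (t : ℕ) => decide ((fire t).map Prod.fst = some a.1) :=
    Primrec.eq.decide.comp
      (Primrec.option_map (hfire.comp Primrec.snd) (Primrec.fst.comp Primrec.snd))
      (Primrec.option_some.comp (Primrec.fst.comp Primrec.fst))
  exact primrec_count h Primrec.snd

theorem primrec_act (hfire : Primrec fire) :
    Primrec fun a : ℕ × List (ℕ × ℕ) => act fire a.1 a.2 := by
  have hs : Primrec fun b : (ℕ × List (ℕ × ℕ)) × (ℕ × ℕ) => b.1.1 + 1 :=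
    Primrec.succ.comp (Primrec.fst.comp Primrec.fst)
  have hk : Primrec fun b : (ℕ × List (ℕ × ℕ)) × (ℕ × ℕ) => b.2.1 := Primrec.fst.comp Primrec.snd
  have hatt : Primrec fun b : (ℕ × List (ℕ × ℕ)) × (ℕ × ℕ) => attack b.2.1 b.2.2 b.1.2 :=
    primrec_attack.comp (Primrec.snd.pair (Primrec.snd.comp Primrec.fst))
  have hbody : Primrec₂ fun (a : ℕ × List (ℕ × ℕ)) (b : ℕ × ℕ) =>
      bif decide (attacks fire b.1 (a.1 + 1) % 2 ^ b.1 = 0) then purge b.1 (attack b.1 b.2 a.2)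
      else attack b.1 b.2 a.2 := Primrec.cond (Primrec.eq.decide.comp (Primrec.nat_mod.comp
      ((primrec_attacks hfire).comp hk hs) (primrec_pow.comp (Primrec.const 2) hk))
      (Primrec.const 0)) (primrec_purge.comp (hk.pair hatt)) hatt
  refine (Primrec.option_casesOn (hfire.comp Primrec.fst) Primrec.snd hbody).of_eq fun a => ?_
  unfold act
  cases fire a.1 <;> rfl

theorem primrec_live (hfire : Primrec fire) : Primrec (live fire) := by
  have h : Primrec₂ fun (_ : Unit) (r : ℕ × List (ℕ × ℕ)) =>
      act fire r.1 r.2 ++ [(r.1, r.1)] := by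
    have h1 : Primrec fun a : Unit × (ℕ × List (ℕ × ℕ)) => a.2.1 := Primrec.fst.comp Primrec.snd
    exact Primrec.list_append.comp ((primrec_act hfire).comp Primrec.snd)
      (Primrec.list_cons.comp (h1.pair h1) (Primrec.const []))
  exact (Primrec.nat_rec (Primrec.const []) h).comp (Primrec.const ()) Primrec.id

theorem primrec_roundsBelow (hfire : Primrec fire) : Primrec₂ (roundsBelow fire) := by
  have h : Primrec₂ fun (a : ℕ × ℕ) (k : ℕ) => rounds fire k a.2 :=
    Primrec.nat_div.comp ((primrec_attacks hfire).comp Primrec.snd (Primrec.snd.comp Primrec.fst))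
      (primrec_pow.comp (Primrec.const 2) Primrec.snd)
  exact primrec_sum_range h Primrec.fst

/-- The entries of `L` with number `x` and bound at most `h`. -/
def entries (h x : ℕ) (L : List (ℕ × ℕ)) : List (ℕ × ℕ) :=
  L.filter fun e => decide (e.1 = x) && decide (e.2 ≤ h)

/-- Whether `x` is dropped, as far as `live fire s` tells for entries of bound at most `h`. -/
def answer (fire : ℕ → Option (ℕ × ℕ)) (h x s : ℕ) : Option Str :=
  bif decide ((live fire s).filter (fun e => decide (e.1 = x)) = []) then some [true]
  else bif decide (entries h x (live fire s) = []) then none else some [false]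

theorem primrec_answer (hfire : Primrec fire) :
    Primrec fun a : ℕ × ℕ × ℕ => answer fire a.1 a.2.1 a.2.2 := by
  have hL : Primrec fun a : ℕ × ℕ × ℕ => live fire a.2.2 :=
    (primrec_live hfire).comp (Primrec.snd.comp Primrec.snd)
  have hx : Primrec₂ fun (a : ℕ × ℕ × ℕ) (e : ℕ × ℕ) => decide (e.1 = a.2.1) :=
    Primrec.eq.decide.comp (Primrec.fst.comp Primrec.snd)
      (Primrec.fst.comp (Primrec.snd.comp Primrec.fst))
  have hp : Primrec₂ fun (a : ℕ × ℕ × ℕ) (e : ℕ × ℕ) => decide (e.2 ≤ a.1) :=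
    Primrec.nat_le.decide.comp (Primrec.snd.comp Primrec.snd) (Primrec.fst.comp Primrec.fst)
  exact Primrec.cond (Primrec.eq.decide.comp (primrec_filter hL hx) (Primrec.const []))
    (Primrec.const (some [true]))
    (Primrec.cond
      (Primrec.eq.decide.comp (primrec_filter hL (Primrec.and.comp hx hp)) (Primrec.const []))
      (Primrec.const none) (Primrec.const (some [false])))

theorem answer_eq_true {h x s : ℕ} (hx : x ∉ liveIds fire s) : answer fire h x s = some [true] := by
  have h0 : (live fire s).filter (fun e => decide (e.1 = x)) = [] :=
    List.filter_eq_nil_iff.2 fun e he hex => hx (List.mem_map.2 ⟨e, he, by simpa using hex⟩)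
  simp [answer, h0]

theorem answer_of_mem {h x s : ℕ} (hx : x ∈ liveIds fire s) :
    answer fire h x s = bif decide (entries h x (live fire s) = []) then none else some [false] := by
  obtain ⟨p, hp⟩ := mem_live_of_mem_liveIds hx
  have h0 : (live fire s).filter (fun e => decide (e.1 = x)) ≠ [] := fun h0 =>
    absurd (List.filter_eq_nil_iff.1 h0 _ hp) (by simp)
  simp [answer, h0]

theorem answer_eq_false {h x s p : ℕ} (hx : (x, p) ∈ live fire s) (hp : p ≤ h) :
    answer fire h x s = some [false] := by
  have h0 : entries h x (live fire s) ≠ [] := fun h0 =>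
    absurd (List.filter_eq_nil_iff.1 h0 _ hx) (by simpa using hp)
  rw [answer_of_mem (mem_liveIds_of_mem_live hx)]
  simp [h0]

theorem exists_mem_of_entries {h x s : ℕ} (h0 : entries h x (live fire s) ≠ []) :
    ∃ p ≤ h, (x, p) ∈ live fire s := by
  obtain ⟨e, he⟩ := List.exists_mem_of_ne_nil _ h0
  obtain ⟨hmem, hcond⟩ := List.mem_filter.1 he
  simp only [Bool.and_eq_true, decide_eq_true_eq] at hcond
  exact ⟨e.2, hcond.2, by rw [← hcond.1]; exact hmem⟩

theorem rePred_dropped (hfire : Primrec fire) : REPred fun n => n ∈ dropped fire := by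
  have h : Primrec₂ fun (x i : ℕ) =>
      decide ((live fire (x + 1 + i)).filter (fun e => decide (e.1 = x)) = []) := by
    have hL : Primrec fun a : ℕ × ℕ => live fire (a.1 + 1 + a.2) :=
      (primrec_live hfire).comp (Primrec.nat_add.comp (Primrec.succ.comp Primrec.fst) Primrec.snd)
    have hx : Primrec₂ fun (a : ℕ × ℕ) (e : ℕ × ℕ) => decide (e.1 = a.1) :=
      Primrec.eq.decide.comp (Primrec.fst.comp Primrec.snd) (Primrec.fst.comp Primrec.fst)
    exact Primrec.eq.decide.comp (primrec_filter hL hx) (Primrec.const [])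
  refine (Partrec.rfind h.to_comp.partrec₂).dom_re.of_eq fun x => ?_
  refine rfind_some_dom.trans ?_
  constructor
  · rintro ⟨i, hi⟩
    refine ⟨x + 1 + i, by omega, fun hmem => ?_⟩
    obtain ⟨p, hp⟩ := mem_live_of_mem_liveIds hmem
    exact absurd (List.filter_eq_nil_iff.1 (of_decide_eq_true hi) _ hp) (by simp)
  · rintro ⟨s, hxs, hs⟩
    refine ⟨s - (x + 1), decide_eq_true (List.filter_eq_nil_iff.2 fun e he hex => hs ?_)⟩
    rw [show x + 1 + (s - (x + 1)) = s by omega] at he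
    exact List.mem_map.2 ⟨e, he, by simpa using hex⟩

/-! ### The interpreter -/

/-- The condition on a stage `t` in the program of level `k` with parameter `v`. An even `v` codes
the number of all rounds of level at most `k`; an odd `v` codes the number of all rounds of
level less than `k / 2` and the number of all attacks of level `k`, modulo `2 ^ k`. -/
def stageTest (fire : ℕ → Option (ℕ × ℕ)) (k v t : ℕ) : Bool :=
  bif decide (v % 2 = 0) then decide (roundsBelow fire (k + 1) t = v / 2)
  else decide (roundsBelow fire (k / 2) t = v / 2 / 2 ^ k) &&
    decide (attacks fire k t % 2 ^ k = v / 2 % 2 ^ k)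

/-- The bounds below which the program of level `k` with parameter `v` trusts an entry. -/
def trustBound (k v : ℕ) : ℕ := bif decide (v % 2 = 0) then k else k / 2

/-- The program of level `k` with parameter `v`. -/
def runProgram (fire : ℕ → Option (ℕ × ℕ)) (k v x : ℕ) : Part (Option Str) :=
  (Nat.rfind fun i => Part.some (stageTest fire k v (x + 1 + i))).map fun i =>
    answer fire (trustBound k v) x (x + 1 + i)

/-- The interpreter for which a string of length `2 * (k + 1)` is a program of level `k`. -/
def interp (fire : ℕ → Option (ℕ × ℕ)) : Interpreter := fun p z =>
  runProgram fire (p.length / 2 - 1) (strNum p + 1 - 4 ^ (p.length / 2)) (strNum z)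

theorem primrec_strNum : Primrec strNum := by
  have h : Primrec₂ fun (_ : Str) (r : ℕ × Bool) => 2 * r.1 + 1 + r.2.toNat :=
    Primrec.nat_add.comp (Primrec.succ.comp (Primrec.nat_mul.comp (Primrec.const 2)
      (Primrec.fst.comp Primrec.snd))) ((Primrec.dom_bool _).comp (Primrec.snd.comp Primrec.snd))
  exact Primrec.list_foldl Primrec.id (Primrec.const 0) h

theorem primrec_stageTest (hfire : Primrec fire) :
    Primrec fun a : ℕ × ℕ × ℕ => stageTest fire a.1 a.2.1 a.2.2 := by
  have hk : Primrec fun a : ℕ × ℕ × ℕ => a.1 := Primrec.fst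
  have hv : Primrec fun a : ℕ × ℕ × ℕ => a.2.1 := Primrec.fst.comp Primrec.snd
  have ht : Primrec fun a : ℕ × ℕ × ℕ => a.2.2 := Primrec.snd.comp Primrec.snd
  have hv2 : Primrec fun a : ℕ × ℕ × ℕ => a.2.1 / 2 := Primrec.nat_div.comp hv (Primrec.const 2)
  have hpow : Primrec fun a : ℕ × ℕ × ℕ => 2 ^ a.1 := primrec_pow.comp (Primrec.const 2) hk
  exact Primrec.cond
    (Primrec.eq.decide.comp (Primrec.nat_mod.comp hv (Primrec.const 2)) (Primrec.const 0))
    (Primrec.eq.decide.comp ((primrec_roundsBelow hfire).comp (Primrec.succ.comp hk) ht) hv2)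
    (Primrec.and.comp
      (Primrec.eq.decide.comp ((primrec_roundsBelow hfire).comp
        (Primrec.nat_div.comp hk (Primrec.const 2)) ht) (Primrec.nat_div.comp hv2 hpow))
      (Primrec.eq.decide.comp (Primrec.nat_mod.comp ((primrec_attacks hfire).comp hk ht) hpow)
        (Primrec.nat_mod.comp hv2 hpow)))

theorem primrec_trustBound : Primrec₂ trustBound :=
  Primrec.cond
    (Primrec.eq.decide.comp (Primrec.nat_mod.comp Primrec.snd (Primrec.const 2)) (Primrec.const 0))
    Primrec.fst (Primrec.nat_div.comp Primrec.fst (Primrec.const 2))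

theorem partrec_runProgram (hfire : Primrec fire) :
    Partrec fun a : ℕ × ℕ × ℕ => runProgram fire a.1 a.2.1 a.2.2 := by
  have hk : Primrec fun b : (ℕ × ℕ × ℕ) × ℕ => b.1.1 := Primrec.fst.comp Primrec.fst
  have hv : Primrec fun b : (ℕ × ℕ × ℕ) × ℕ => b.1.2.1 :=
    Primrec.fst.comp (Primrec.snd.comp Primrec.fst)
  have hx : Primrec fun b : (ℕ × ℕ × ℕ) × ℕ => b.1.2.2 :=
    Primrec.snd.comp (Primrec.snd.comp Primrec.fst)
  have ht : Primrec fun b : (ℕ × ℕ × ℕ) × ℕ => b.1.2.2 + 1 + b.2 :=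
    Primrec.nat_add.comp (Primrec.succ.comp hx) Primrec.snd
  have h1 : Primrec₂ fun (a : ℕ × ℕ × ℕ) (i : ℕ) =>
      stageTest fire a.1 a.2.1 (a.2.2 + 1 + i) :=
    (primrec_stageTest hfire).comp (hk.pair (hv.pair ht))
  have h2 : Primrec₂ fun (a : ℕ × ℕ × ℕ) (i : ℕ) =>
      answer fire (trustBound a.1 a.2.1) a.2.2 (a.2.2 + 1 + i) :=
    (primrec_answer hfire).comp ((primrec_trustBound.comp hk hv).pair (hx.pair ht))
  exact (Partrec.rfind h1.to_comp.partrec₂).map h2.to_comp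

theorem partrec_interp (hfire : Primrec fire) : Partrec₂ (interp fire) := by
  have hl : Primrec fun a : Str × Str => a.1.length / 2 :=
    Primrec.nat_div.comp (Primrec.list_length.comp Primrec.fst) (Primrec.const 2)
  exact (partrec_runProgram hfire).comp
    ((Primrec.nat_sub.comp hl (Primrec.const 1)).pair
      ((Primrec.nat_sub.comp (Primrec.succ.comp (primrec_strNum.comp Primrec.fst))
        (primrec_pow.comp (Primrec.const 4) hl)).pair
        (primrec_strNum.comp Primrec.snd))).to_comp

end Construction

/-! ### Instance complexity of attacked numbers -/

theorem two_pow_length_le_strNum (p : Str) :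
    2 ^ p.length ≤ strNum p + 1 ∧ strNum p + 1 < 2 ^ (p.length + 1) := by
  induction p using List.reverseRecOn with
  | nil => simp [strNum]
  | append_singleton p b ih =>
    rw [strNum_concat, List.length_append, List.length_singleton, pow_succ, pow_succ]
    rw [pow_succ] at ih
    cases b <;> simp <;> omega

/-- The strings of length `2 * (k + 1)` are numbered consecutively from `4 ^ (k + 1) - 1`, so the
length carries the level and the offset carries the parameter. -/
theorem exists_str_of_lt {k v : ℕ} (hv : v < 4 ^ (k + 1)) :
    ∃ p : Str, p.length = 2 * (k + 1) ∧ strNum p + 1 = 4 ^ (k + 1) + v := by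
  have hpos : 0 < 4 ^ (k + 1) := by positivity
  obtain ⟨p, hp⟩ := strNum_bijective.2 (4 ^ (k + 1) + v - 1)
  have hp' : strNum p + 1 = 4 ^ (k + 1) + v := by omega
  refine ⟨p, ?_, hp'⟩
  obtain ⟨h1, h2⟩ := two_pow_length_le_strNum p
  have h4 : (4 : ℕ) ^ (k + 1) = 2 ^ (2 * (k + 1)) := by rw [pow_mul]; norm_num
  rw [hp', h4] at h1 h2
  rw [h4] at hv
  have h3 : 2 ^ p.length < 2 ^ (2 * (k + 1) + 1) := by rw [pow_succ]; omega
  have h5 : 2 ^ (2 * (k + 1)) < 2 ^ (p.length + 1) := by omega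
  have h6 := (Nat.pow_lt_pow_iff_right (by norm_num : 1 < 2)).1 h3
  have h7 := (Nat.pow_lt_pow_iff_right (by norm_num : 1 < 2)).1 h5
  omega

section Construction

variable {fire : ℕ → Option (ℕ × ℕ)}

/-- The hypothesis `hev` makes the program total. By `hfin`, entries trusted at a stage that passes
the test are never dropped, which gives consistency. By `hx`, the answer at `x` itself is not `⊥`.
-/
theorem ic_interp_le {k v : ℕ} {x : Str} (hv : v < 4 ^ (k + 1))
    (hev : ∃ s, ∀ t, s ≤ t → stageTest fire k v t = true)
    (hfin : ∀ t, stageTest fire k v t = true → ∀ t', t ≤ t' → ∀ l < trustBound k v,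
      rounds fire l t = rounds fire l t')
    (hx : ∀ t, strNum x < t → stageTest fire k v t = true →
      Settled fire (trustBound k v) t (strNum x)) :
    ic (interp fire) (strNum ⁻¹' dropped fire) x ≤ (2 * (k + 1) : ℕ) := by
  obtain ⟨p, hlen, hp⟩ := exists_str_of_lt hv
  have hrun : ∀ z, interp fire p z = runProgram fire k v (strNum z) := fun z => by
    rw [interp, hlen, hp, Nat.mul_div_cancel_left _ (by norm_num : 0 < 2), Nat.add_sub_cancel,
      Nat.add_sub_cancel_left]
  have hval : ∀ z y, y ∈ interp fire p z → ∃ t, strNum z < t ∧ stageTest fire k v t = true ∧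
      y = answer fire (trustBound k v) (strNum z) t := by
    intro z y hy
    rw [hrun, runProgram, Part.mem_map_iff] at hy
    obtain ⟨i, hi, rfl⟩ := hy
    have := Nat.rfind_spec hi
    rw [Part.mem_some_iff] at this
    exact ⟨_, by omega, this.symm, rfl⟩
  have hdom : ∀ z, (interp fire p z).Dom := by
    intro z
    rw [hrun]
    obtain ⟨s, hs⟩ := hev
    exact rfind_some_dom.2 ⟨s, hs _ (by omega)⟩
  have htrue : ∀ z t, strNum z < t → strNum z ∉ liveIds fire t →
      answer fire (trustBound k v) (strNum z) t = some (chi (strNum ⁻¹' dropped fire) z) := by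
    intro z t hzt hz
    have : z ∈ strNum ⁻¹' dropped fire := ⟨t, hzt, hz⟩
    rw [answer_eq_true hz]
    simp [chi, this]
  have hfalse : ∀ z t q, stageTest fire k v t = true → (strNum z, q) ∈ live fire t →
      q ≤ trustBound k v →
      answer fire (trustBound k v) (strNum z) t = some (chi (strNum ⁻¹' dropped fire) z) := by
    intro z t q ht hq hle
    have : z ∉ strNum ⁻¹' dropped fire := notMem_dropped hq hle (hfin t ht)
    rw [answer_eq_false hq hle]
    simp [chi, this]
  refine (iInf₂_le (α := ℕ∞) p ?_).trans (by rw [hlen])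
  refine ⟨hdom, fun z y hy => ?_, ?_⟩
  · obtain ⟨t, hzt, ht, rfl⟩ := hval z y hy
    by_cases hz : strNum z ∈ liveIds fire t
    · by_cases h0 : entries (trustBound k v) (strNum z) (live fire t) = []
      · right
        rw [answer_of_mem hz, decide_eq_true h0, cond_true]
      · obtain ⟨q, hle, hq⟩ := exists_mem_of_entries h0
        exact Or.inl (hfalse z t q ht hq hle)
    · exact Or.inl (htrue z t hzt hz)
  · obtain ⟨y, hy⟩ := Part.dom_iff_mem.1 (hdom x)
    obtain ⟨t, hzt, ht, rfl⟩ := hval x y hy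
    suffices answer fire (trustBound k v) (strNum x) t =
      some (chi (strNum ⁻¹' dropped fire) x) from this ▸ hy
    by_cases hz : strNum x ∈ liveIds fire t
    · obtain ⟨q, hq⟩ := mem_live_of_mem_liveIds hz
      exact hfalse x t q ht hq (hx t hzt ht q hq)
    · exact htrue x t hzt hz

theorem roundsBelow_mono (h : ℕ) : Monotone (roundsBelow fire h) :=
  fun _ _ hst => Finset.sum_le_sum fun k _ => rounds_mono k hst

theorem rounds_eq_of_roundsBelow_le {h t t' : ℕ} (htt : t ≤ t')
    (hle : roundsBelow fire h t' ≤ roundsBelow fire h t) {l : ℕ} (hl : l < h) :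
    rounds fire l t = rounds fire l t' :=
  (Finset.sum_eq_sum_iff_of_le fun k _ => rounds_mono k htt).1
    (le_antisymm (roundsBelow_mono h htt) hle) l (Finset.mem_range.2 hl)

/-- Level `l` has at most `8 ^ l / 2 ^ l = 4 ^ l` rounds. The factor `3` from the geometric sum
leaves room for the parity bit of the parameter. -/
theorem roundsBelow_bound (hb : ∀ k s, attacks fire k s ≤ 8 ^ k) (h s : ℕ) :
    3 * roundsBelow fire h s + 1 ≤ 4 ^ h := by
  induction h with
  | zero => simp [roundsBelow]
  | succ h ih =>
    have h1 : rounds fire h s ≤ 4 ^ h := by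
      refine (Nat.div_le_div_right (hb h s)).trans (le_of_eq ?_)
      rw [show (8 : ℕ) = 4 * 2 by norm_num, mul_pow, Nat.mul_div_cancel _ (by positivity)]
    rw [roundsBelow, Finset.sum_range_succ, pow_succ]
    rw [roundsBelow] at ih
    omega

theorem ic_interp_le_of_attack (hb : ∀ k s, attacks fire k s ≤ 8 ^ k) {s k : ℕ} {x : Str}
    (hs : fire s = some (k, strNum x)) (hxs : strNum x < s) :
    ic (interp fire) (strNum ⁻¹' dropped fire) x ≤ (2 * (k + 1) : ℕ) := by
  -- At `s₀` all levels up to `k` have come to rest; the parameters are the final values of the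
  -- counters.
  obtain ⟨s₀, hs₀⟩ := exists_rounds_const (b := fun k => 8 ^ k) hb (k + 1)
  have hconst : ∀ h ≤ k + 1, ∀ t, s₀ ≤ t → roundsBelow fire h t = roundsBelow fire h s₀ :=
    fun h hh t ht => Finset.sum_congr rfl fun l hl => by
      rw [rounds, rounds, hs₀ t ht l (lt_of_lt_of_le (Finset.mem_range.1 hl) hh)]
  have hle : ∀ h ≤ k + 1, ∀ t, roundsBelow fire h t ≤ roundsBelow fire h s₀ := fun h hh t =>
    (roundsBelow_mono h (le_max_left t s₀)).trans (hconst h hh _ (le_max_right _ _)).le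
  -- First case: a round of level `k` ends at a stage `r` after `x` has entered. A stage with the
  -- final number of rounds of level at most `k` must lie beyond `r`.
  by_cases hround : ∃ t, rounds fire k (strNum x + 1) < rounds fire k t
  · obtain ⟨t, ht⟩ := hround
    have hxt : strNum x + 1 ≤ t := by
      by_contra h
      exact absurd (rounds_mono (fire := fire) k (not_le.1 h).le) (not_le.2 ht)
    obtain ⟨r, y, hxr, -, hr, hmod⟩ := exists_round_of_rounds_lt hxt ht
    have hlt := rounds_succ_of_attack hr hmod
    have htb : trustBound k (2 * roundsBelow fire (k + 1) s₀) = k := by simp [trustBound]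
    have htest : ∀ t, stageTest fire k (2 * roundsBelow fire (k + 1) s₀) t = true ↔
        roundsBelow fire (k + 1) t = roundsBelow fire (k + 1) s₀ := fun t => by simp [stageTest]
    refine ic_interp_le (v := 2 * roundsBelow fire (k + 1) s₀) ?_ ⟨s₀, fun t ht => ?_⟩ ?_ ?_
    · have := roundsBelow_bound hb (k + 1) s₀
      omega
    · exact (htest t).2 (hconst _ le_rfl t ht)
    · intro t ht t' htt l hl
      rw [htb] at hl
      exact rounds_eq_of_roundsBelow_le htt ((hle _ le_rfl t').trans ((htest t).1 ht).ge)
        (hl.trans (Nat.lt_succ_self k))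
    · intro t hxt ht
      rw [htb]
      have hrt : r < t := by
        by_contra h
        have h1 := rounds_mono (fire := fire) k (not_lt.1 h)
        have h2 := rounds_eq_of_roundsBelow_le (fire := fire)
          ((not_lt.1 h).trans (Nat.le_add_right r 1))
          ((hle _ le_rfl (r + 1)).trans ((htest t).1 ht).ge) (Nat.lt_succ_self k)
        omega
      exact (settled_of_round (Nat.lt_of_succ_le hxr) hr hmod).mono (by omega) hrt
  -- Second case: from stage `x + 1` on, the quotient of the attack count by `2 ^ k` is constant.
  -- Its residue then determines the count, so a stage beyond `x` that passes the test has seen all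
  -- attacks of level `k`, including the one on `x`.
  · push Not at hround
    have h2k : 0 < 2 ^ k := by positivity
    have hmodlt : attacks fire k s₀ % 2 ^ k < 2 ^ k := Nat.mod_lt _ h2k
    set κ := roundsBelow fire (k / 2) s₀ with hκ
    set j := attacks fire k s₀ % 2 ^ k with hj
    have hv1 : (2 * (κ * 2 ^ k + j) + 1) / 2 = κ * 2 ^ k + j := by omega
    have hv2 : (κ * 2 ^ k + j) / 2 ^ k = κ := by
      rw [mul_comm, Nat.mul_add_div h2k, Nat.div_eq_of_lt hmodlt, add_zero]
    have hv3 : (κ * 2 ^ k + j) % 2 ^ k = j := by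
      rw [mul_comm, Nat.mul_add_mod, Nat.mod_eq_of_lt hmodlt]
    have hodd : (2 * (κ * 2 ^ k + j) + 1) % 2 ≠ 0 := by omega
    have htb : trustBound k (2 * (κ * 2 ^ k + j) + 1) = k / 2 := by
      rw [trustBound, decide_eq_false hodd, cond_false]
    have htest : ∀ t, stageTest fire k (2 * (κ * 2 ^ k + j) + 1) t = true ↔
        roundsBelow fire (k / 2) t = κ ∧ attacks fire k t % 2 ^ k = j := fun t => by
      rw [stageTest, decide_eq_false hodd, cond_false, hv1, hv2, hv3, Bool.and_eq_true,
        decide_eq_true_eq, decide_eq_true_eq]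
    have hk2 : k / 2 ≤ k + 1 := by omega
    refine ic_interp_le (v := 2 * (κ * 2 ^ k + j) + 1) ?_ ⟨s₀, fun t ht => ?_⟩ ?_ ?_
    -- Both `κ` and `j` are below `2 ^ k`; halving the level in the first counter is what makes the
    -- pair fit into `4 ^ k`.
    · have h1 := roundsBelow_bound hb (k / 2) s₀
      rw [← hκ] at h1
      have h2 : 4 ^ (k / 2) ≤ 2 ^ k := by
        rw [show (4 : ℕ) = 2 ^ 2 by norm_num, ← pow_mul]
        exact Nat.pow_le_pow_right (by norm_num) (by omega)
      have h3 : κ + 1 ≤ 2 ^ k := by omega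
      have h4 : (κ + 1) * 2 ^ k ≤ 2 ^ k * 2 ^ k := Nat.mul_le_mul_right _ h3
      have h5 : 2 ^ k * 2 ^ k = 4 ^ k := by rw [← mul_pow]; norm_num
      rw [h5, Nat.add_mul, Nat.one_mul] at h4
      rw [pow_succ]
      omega
    · exact (htest t).2 ⟨hconst _ hk2 t ht, by rw [hs₀ t ht k (Nat.lt_succ_self k)]⟩
    · intro t ht t' htt l hl
      rw [htb] at hl
      exact rounds_eq_of_roundsBelow_le htt ((hle _ hk2 t').trans ((htest t).1 ht).1.ge) hl
    · intro t hxt ht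
      rw [htb]
      have hst : s < t := by
        by_contra h
        have hsucc : attacks fire k (s + 1) = attacks fire k s + 1 := by simp [attacks_succ, hs]
        have h1 := attacks_mono (fire := fire) k (not_lt.1 h)
        have hm : attacks fire k (max (s + 1) s₀) = attacks fire k s₀ :=
          hs₀ _ (le_max_right _ _) k (Nat.lt_succ_self k)
        have h2 := attacks_mono (fire := fire) k (le_max_left (s + 1) s₀)
        have hr : ∀ t, strNum x < t → rounds fire k t = rounds fire k (strNum x + 1) :=
          fun t ht => le_antisymm (hround t) (rounds_mono k ht)
        have hdiv : attacks fire k t / 2 ^ k = attacks fire k s₀ / 2 ^ k := by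
          rw [← hm]
          exact (hr t hxt).trans (hr _ (by omega)).symm
        have h3 : attacks fire k t = attacks fire k s₀ := by
          rw [← Nat.div_add_mod (attacks fire k t) (2 ^ k), hdiv, ((htest t).1 ht).2, hj,
            Nat.div_add_mod]
        omega
      exact (settled_of_attack hxs hs).mono (by omega) hst

end Construction

/-! ### The attacks -/

theorem two_pow_mul_odd_inj {a b m n : ℕ} (h : 2 ^ a * (2 * m + 1) = 2 ^ b * (2 * n + 1)) :
    a = b ∧ m = n := by
  induction a generalizing b with
  | zero =>
    cases b with
    | zero => omega
    | succ b =>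
      rw [pow_succ, mul_right_comm] at h
      omega
  | succ a ih =>
    cases b with
    | zero =>
      rw [pow_succ, mul_right_comm] at h
      omega
    | succ b =>
      rw [pow_succ, pow_succ, mul_right_comm, mul_right_comm (2 ^ b)] at h
      have := ih (Nat.eq_of_mul_eq_mul_right two_pos h)
      omega

/-- A partial recursive function that contains every other one with linear overhead. -/
def universalFn : ℕ →. ℕ := fun i =>
  (Nat.rfind fun w => Part.some (decide (2 ^ w.unpair.1 * (2 * w.unpair.2 + 1) = i))).bind fun w =>
    eval (Denumerable.ofNat Code w.unpair.1) w.unpair.2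

theorem partrec_universalFn : Partrec universalFn := by
  have h : Primrec₂ fun (i w : ℕ) => decide (2 ^ w.unpair.1 * (2 * w.unpair.2 + 1) = i) := by
    have hw : Primrec fun a : ℕ × ℕ => a.2.unpair := Primrec.unpair.comp Primrec.snd
    exact Primrec.eq.decide.comp (Primrec.nat_mul.comp
      (primrec_pow.comp (Primrec.const 2) (Primrec.fst.comp hw))
      (Primrec.succ.comp (Primrec.nat_mul.comp (Primrec.const 2) (Primrec.snd.comp hw))))
      Primrec.fst
  have hw : Computable fun a : ℕ × ℕ => a.2.unpair := Computable.unpair.comp Computable.snd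
  exact (Partrec.rfind h.to_comp.partrec₂).bind (Nat.Partrec.Code.eval_part.comp
    ((Computable.ofNat Code).comp (Computable.fst.comp hw)) (Computable.snd.comp hw))

/-- The index grows only by a constant factor, hence its binary length by a constant. The quadratic
growth of `Nat.pair` would double the length and spoil the ratio `2 / 3`. -/
theorem exists_index {φ : ℕ →. ℕ} (hφ : Nat.Partrec φ) :
    ∃ c, ∀ n, universalFn (2 ^ c * (2 * n + 1)) = φ n := by
  obtain ⟨c, rfl⟩ := Code.exists_code.1 hφ
  refine ⟨Encodable.encode c, fun n => ?_⟩
  have hdom : (Nat.rfind fun w => Part.some (decide (2 ^ w.unpair.1 * (2 * w.unpair.2 + 1) =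
      2 ^ Encodable.encode c * (2 * n + 1)))).Dom :=
    rfind_some_dom.2 ⟨Nat.pair (Encodable.encode c) n, by simp⟩
  obtain ⟨w, hw⟩ := Part.dom_iff_mem.1 hdom
  have hspec := Nat.rfind_spec hw
  rw [Part.mem_some_iff, Bool.true_eq, decide_eq_true_eq] at hspec
  obtain ⟨h1, h2⟩ := two_pow_mul_odd_inj hspec
  rw [universalFn, Part.eq_some_iff.2 hw, Part.bind_some, h1, h2, Denumerable.ofNat_encode]

/-- The value of `c` at `i`, provided that it is found at stage `t` and less than `t`. -/
def valueAt (c : Code) (i t : ℕ) : Option ℕ :=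
  (evaln t c i).bind fun y => bif decide (y < t) then some y else none

theorem mem_valueAt {c : Code} {i t y : ℕ} :
    valueAt c i t = some y ↔ y ∈ evaln t c i ∧ y < t := by
  rw [valueAt, Option.bind_eq_some_iff]
  constructor
  · rintro ⟨z, hz, h⟩
    by_cases hzt : z < t <;> simp [hzt] at h
    exact h ▸ ⟨hz, hzt⟩
  · rintro ⟨h1, h2⟩
    exact ⟨y, h1, by simp [h2]⟩

theorem valueAt_mono {c : Code} {i t t' y : ℕ} (htt : t ≤ t') (h : valueAt c i t = some y) :
    valueAt c i t' = some y := by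
  rw [mem_valueAt] at h ⊢
  exact ⟨Nat.Partrec.Code.evaln_mono htt h.1, h.2.trans_le htt⟩

/-- The schedule of the attacks: for every `k`, every `i < 8 ^ k` attacks the value of `c` at `i`
once at level `k`, if there is such a value. -/
def schedule (c : Code) (s : ℕ) : Option (ℕ × ℕ) :=
  bif decide (s.unpair.1.unpair.2 < 8 ^ s.unpair.1.unpair.1) &&
      decide (valueAt c s.unpair.1.unpair.2 (s.unpair.2 - 1) = none)
  then (valueAt c s.unpair.1.unpair.2 s.unpair.2).map fun y => (s.unpair.1.unpair.1, y)
  else none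

theorem primrec_schedule (c : Code) : Primrec (schedule c) := by
  have hval : Primrec₂ (valueAt c) := by
    refine Primrec.option_bind (Nat.Partrec.Code.primrec_evaln.comp
      ((Primrec.snd.pair (Primrec.const c)).pair Primrec.fst)) ?_
    exact Primrec.cond (Primrec.nat_lt.decide.comp Primrec.snd (Primrec.snd.comp Primrec.fst))
      (Primrec.option_some.comp Primrec.snd) (Primrec.const none)
  have h1 : Primrec fun s : ℕ => s.unpair.1.unpair :=
    Primrec.unpair.comp (Primrec.fst.comp Primrec.unpair)
  have h2 : Primrec fun s : ℕ => s.unpair.2 := Primrec.snd.comp Primrec.unpair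
  have h3 : Primrec₂ fun (s y : ℕ) => (s.unpair.1.unpair.1, y) :=
    ((Primrec.fst.comp h1).comp Primrec.fst).pair Primrec.snd
  exact Primrec.cond (Primrec.and.comp
    (Primrec.nat_lt.decide.comp (Primrec.snd.comp h1)
      (primrec_pow.comp (Primrec.const 8) (Primrec.fst.comp h1)))
    (Primrec.eq.decide.comp (hval.comp (Primrec.snd.comp h1)
      (Primrec.nat_sub.comp h2 (Primrec.const 1))) (Primrec.const none)))
    (Primrec.option_map (hval.comp (Primrec.snd.comp h1) h2) h3) (Primrec.const none)

theorem schedule_eq_some {c : Code} {s k y : ℕ} : schedule c s = some (k, y) ↔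
    s.unpair.1.unpair.1 = k ∧ s.unpair.1.unpair.2 < 8 ^ k ∧
      valueAt c s.unpair.1.unpair.2 (s.unpair.2 - 1) = none ∧
      valueAt c s.unpair.1.unpair.2 s.unpair.2 = some y := by
  unfold schedule
  constructor
  · intro h
    by_cases h1 : s.unpair.1.unpair.2 < 8 ^ s.unpair.1.unpair.1
    · by_cases h2 : valueAt c s.unpair.1.unpair.2 (s.unpair.2 - 1) = none
      · rw [decide_eq_true h1, decide_eq_true h2, Bool.and_true, cond_true,
          Option.map_eq_some_iff] at h
        obtain ⟨z, hz, heq⟩ := h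
        obtain ⟨rfl, rfl⟩ := Prod.mk.inj heq
        exact ⟨rfl, h1, h2, hz⟩
      · rw [decide_eq_false h2, Bool.and_false, cond_false] at h
        cases h
    · rw [decide_eq_false h1, Bool.false_and, cond_false] at h
      cases h
  · rintro ⟨rfl, h1, h2, h3⟩
    simp [h1, h2, h3]

/-- A number is attacked only after it has entered the list. For the same reason, an attack on the
number `u` takes place after stage `u`. -/
theorem lt_of_schedule {c : Code} {s k y : ℕ} (h : schedule c s = some (k, y)) : y < s :=
  ((mem_valueAt.1 (schedule_eq_some.1 h).2.2.2).2).trans_le (Nat.unpair_right_le s)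

theorem exists_schedule {c : Code} {i k y : ℕ} (hy : y ∈ eval c i) (hi : i < 8 ^ k) :
    ∃ s, schedule c s = some (k, y) ∧ s.unpair.1.unpair.2 = i := by
  have hex : ∃ t, valueAt c i t = some y := by
    obtain ⟨t, ht⟩ := Nat.Partrec.Code.evaln_complete.1 hy
    exact ⟨max t (y + 1), mem_valueAt.2
      ⟨Nat.Partrec.Code.evaln_mono (le_max_left _ _) ht, le_max_right t (y + 1)⟩⟩
  classical
  have h1 := Nat.find_spec hex
  have hpos := (mem_valueAt.1 h1).2
  have h2 : valueAt c i (Nat.find hex - 1) = none := by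
    by_contra h
    obtain ⟨z, hz⟩ := Option.ne_none_iff_exists'.1 h
    have hzy := valueAt_mono (Nat.sub_le _ 1) hz
    rw [h1] at hzy
    refine Nat.find_min hex (show Nat.find hex - 1 < Nat.find hex by omega) ?_
    rw [hz, hzy]
  refine ⟨Nat.pair (Nat.pair k i) (Nat.find hex), ?_, by simp⟩
  rw [schedule_eq_some]
  simp only [Nat.unpair_pair]
  exact ⟨trivial, hi, h2, h1⟩

/-- A value that has been found persists, so it is new at one stage only. This limits level `k` to
`8 ^ k` attacks. -/
theorem schedule_stage_unique {c : Code} {s t k y z : ℕ} (hs : schedule c s = some (k, y))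
    (ht : schedule c t = some (k, z)) (hst : s.unpair.1.unpair.2 = t.unpair.1.unpair.2) :
    s = t := by
  obtain ⟨h1, -, h3, h4⟩ := schedule_eq_some.1 hs
  obtain ⟨h1', -, h3', h4'⟩ := schedule_eq_some.1 ht
  rw [← hst] at h3' h4'
  have key : ∀ {a b y}, valueAt c s.unpair.1.unpair.2 a = some y →
      valueAt c s.unpair.1.unpair.2 (b - 1) = none → ¬ a < b := by
    intro a b y ha hb hab
    rw [valueAt_mono (show a ≤ b - 1 by omega) ha] at hb
    cases hb
  have h2 : s.unpair.2 = t.unpair.2 :=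
    le_antisymm (not_lt.1 (key h4' h3)) (not_lt.1 (key h4 h3'))
  rw [← Nat.pair_unpair s, ← Nat.pair_unpair t, h2, ← Nat.pair_unpair s.unpair.1,
    ← Nat.pair_unpair t.unpair.1, h1, h1', hst]

theorem attacks_eq_card (fire : ℕ → Option (ℕ × ℕ)) (k s : ℕ) : attacks fire k s =
    ((Finset.range s).filter fun t => (fire t).map Prod.fst = some k).card := by
  rw [attacks, Nat.count_eq_card_filter_range]
  congr 1
  exact Finset.filter_congr fun t _ => decide_eq_true_iff

theorem attacks_schedule_le (c : Code) (k s : ℕ) : attacks (schedule c) k s ≤ 8 ^ k := by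
  rw [attacks_eq_card, ← Finset.card_range (8 ^ k)]
  refine Finset.card_le_card_of_injOn (fun t => t.unpair.1.unpair.2) ?_ ?_
  · intro t ht
    obtain ⟨⟨k', y⟩, hy, rfl⟩ := Option.map_eq_some_iff.1 (Finset.mem_filter.1 ht).2
    exact Finset.mem_coe.2 (Finset.mem_range.2 (schedule_eq_some.1 hy).2.1)
  · intro t ht t' ht' heq
    obtain ⟨⟨k', y⟩, hy, rfl⟩ := Option.map_eq_some_iff.1 (Finset.mem_filter.1 ht).2
    obtain ⟨⟨k'', z⟩, hz, hk⟩ := Option.map_eq_some_iff.1 (Finset.mem_filter.1 ht').2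
    obtain rfl : k'' = k' := hk
    exact schedule_stage_unique hy hz heq

/-- A function that outputs a stage number `u` thereby provokes attacks later than stage `u`, one
for each index. -/
theorem exists_attacks_add_card_le {c : Code} {k u : ℕ} {J : Finset ℕ}
    (hJ : ∀ i ∈ J, i < 8 ^ k ∧ u ∈ eval c i) :
    ∃ t, u ≤ t ∧ attacks (schedule c) k u + J.card ≤ attacks (schedule c) k t := by
  choose! σ hσ hlab using fun i (hi : i ∈ J) => exists_schedule (hJ i hi).2 (hJ i hi).1
  have hinj : Set.InjOn σ J := fun i hi j hj hij => by rw [← hlab i hi, ← hlab j hj, hij]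
  refine ⟨u + ∑ i ∈ J, (σ i + 1), Nat.le_add_right _ _, ?_⟩
  rw [attacks_eq_card, attacks_eq_card, ← Finset.card_image_of_injOn hinj,
    ← Finset.card_union_of_disjoint]
  · refine Finset.card_le_card (Finset.union_subset ?_ ?_)
    · exact Finset.filter_subset_filter _ (Finset.range_mono (Nat.le_add_right _ _))
    · intro s hs
      obtain ⟨i, hi, rfl⟩ := Finset.mem_image.1 hs
      refine Finset.mem_filter.2 ⟨Finset.mem_range.2 ?_, by rw [hσ i hi]; rfl⟩
      have := Finset.single_le_sum (f := fun i => σ i + 1) (fun _ _ => Nat.zero_le _) hi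
      omega
  · refine Finset.disjoint_left.2 fun s hs hs' => ?_
    obtain ⟨i, hi, rfl⟩ := Finset.mem_image.1 hs'
    have h1 := lt_of_schedule (hσ i hi)
    have h2 := Finset.mem_range.1 (Finset.mem_filter.1 hs).1
    omega

/-! ### The set is effectively simple -/

theorem primrec_entryBound : Primrec entryBound :=
  Primrec.nat_add.comp Primrec.succ (Primrec.nat_mul.comp Primrec.succ
    (primrec_pow.comp (Primrec.const 8)
      (Primrec.succ.comp (Primrec.succ.comp (Primrec.nat_mul.comp (Primrec.const 2) Primrec.id)))))

/-- The first stage at which more than `entryBound k` elements of `W e` are known; the last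
component of the argument is ignored. -/
def crowdedStage : ℕ →. ℕ := fun n => Nat.rfind fun u => Part.some
  (decide (entryBound n.unpair.1.unpair.2 <
    Nat.count (fun x => stageMem (Denumerable.ofNat Code n.unpair.1.unpair.1) u x = true) u))

theorem partrec_crowdedStage : Partrec crowdedStage := by
  have hn : Primrec fun a : ℕ × ℕ => a.1.unpair.1.unpair :=
    Primrec.unpair.comp (Primrec.fst.comp (Primrec.unpair.comp Primrec.fst))
  have h1 : Primrec₂ fun (a : ℕ × ℕ) (x : ℕ) =>
      stageMem (Denumerable.ofNat Code a.1.unpair.1.unpair.1) a.2 x :=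
    primrec_stageMem.comp (((Primrec.snd.comp Primrec.fst).pair
      ((Primrec.ofNat Code).comp ((Primrec.fst.comp hn).comp Primrec.fst))).pair Primrec.snd)
  have h2 : Primrec₂ fun (n u : ℕ) => decide (entryBound n.unpair.1.unpair.2 <
      Nat.count (fun x => stageMem (Denumerable.ofNat Code n.unpair.1.unpair.1) u x = true) u) :=
    Primrec.nat_lt.decide.comp (primrec_entryBound.comp (Primrec.snd.comp hn))
      (primrec_count h1 Primrec.snd)
  exact Partrec.rfind h2.to_comp.partrec₂

/-- For `k ≥ 6` the inner pair is below `2 ^ k`, so the outer pair is below `4 ^ k`, and the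
remaining factor `2 ^ (c + 1)` is at most `2 ^ k`. -/
theorem index_lt {c e k j : ℕ} (hk : e + c + 6 ≤ k) (hj : j < 2 ^ k) :
    2 ^ c * (2 * Nat.pair (Nat.pair e k) j + 1) < 8 ^ k := by
  have hsq : ∀ k, 6 ≤ k → (k + 1) ^ 2 ≤ 2 ^ k := by
    intro k hk
    induction k, hk using Nat.le_induction with
    | base => norm_num
    | succ k hk ih =>
      rw [pow_succ 2 k]
      nlinarith
  have h1 : Nat.pair e k < 2 ^ k := by
    have h := Nat.pair_lt_max_add_one_sq e k
    rw [max_eq_right (by omega)] at h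
    exact h.trans_le (hsq k (by omega))
  have h2 : Nat.pair (Nat.pair e k) j < (2 ^ k) ^ 2 :=
    (Nat.pair_lt_max_add_one_sq _ _).trans_le (Nat.pow_le_pow_left (by omega) 2)
  have h3 : 2 ^ (c + 1) ≤ 2 ^ k := Nat.pow_le_pow_right (by norm_num) (by omega)
  calc 2 ^ c * (2 * Nat.pair (Nat.pair e k) j + 1)
      < 2 ^ c * (2 * (2 ^ k) ^ 2) := Nat.mul_lt_mul_of_pos_left (by omega) (by positivity)
    _ = 2 ^ (c + 1) * (2 ^ k) ^ 2 := by ring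
    _ ≤ 2 ^ k * (2 ^ k) ^ 2 := Nat.mul_le_mul_right _ h3
    _ = 8 ^ k := by rw [← pow_succ', ← pow_mul, mul_comm, pow_mul]; norm_num

theorem exists_count_stageMem {c : Code} {S : Finset ℕ} (hS : ∀ x ∈ S, (eval c x).Dom) :
    ∃ u, S.card ≤ Nat.count (fun x => stageMem c u x = true) u := by
  choose! σ hσ using fun x (hx : x ∈ S) => exists_stageMem_iff.2 (hS x hx)
  refine ⟨∑ x ∈ S, σ x, ?_⟩
  rw [Nat.count_eq_card_filter_range]
  refine Finset.card_le_card fun x hx => ?_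
  have h := stageMem_mono (Finset.single_le_sum (f := σ) (fun _ _ => Nat.zero_le _) hx) (hσ x hx)
  exact Finset.mem_filter.2 ⟨Finset.mem_range.2 (stageMem_lt h), h⟩

theorem effectivelySimple_dropped {c : Code} (hc : eval c = universalFn) :
    EffectivelySimple (dropped (schedule c)) := by
  refine ⟨rePred_dropped (primrec_schedule c),
    infinite_compl_dropped (attacks_schedule_le c), ?_⟩
  obtain ⟨d, hd⟩ := exists_index (Partrec.nat_iff.1 partrec_crowdedStage)
  refine ⟨fun e => entryBound (e + d + 6), (primrec_entryBound.comp
    (Primrec.nat_add.comp (Primrec.nat_add.comp Primrec.id (Primrec.const d))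
      (Primrec.const 6))).to_comp, fun e he => ?_⟩
  set k := e + d + 6 with hk
  by_contra hlt
  rw [not_le] at hlt
  obtain ⟨S, hSW, hS⟩ := Set.exists_subset_encard_eq (Order.add_one_le_of_lt hlt)
  have hfin : S.Finite := Set.finite_of_encard_eq_coe (k := entryBound k + 1) (by exact_mod_cast hS)
  have hcard : hfin.toFinset.card = entryBound k + 1 := by
    rw [hfin.encard_eq_coe_toFinset_card] at hS
    exact_mod_cast hS
  obtain ⟨u₀, hu₀⟩ := exists_count_stageMem (c := Denumerable.ofNat Code e) (S := hfin.toFinset)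
    fun x hx => hSW (hfin.mem_toFinset.1 hx)
  have hdom : (crowdedStage (Nat.pair (Nat.pair e k) 0)).Dom :=
    rfind_some_dom.2 ⟨u₀, by simp; omega⟩
  obtain ⟨u, hu⟩ := Part.dom_iff_mem.1 hdom
  have hspec := Nat.rfind_spec hu
  simp only [Part.mem_some_iff, Bool.true_eq, decide_eq_true_eq, Nat.unpair_pair,
    Nat.count_eq_card_filter_range] at hspec
  have hsame : ∀ j, crowdedStage (Nat.pair (Nat.pair e k) j) =
      crowdedStage (Nat.pair (Nat.pair e k) 0) := fun j => by simp [crowdedStage]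
  -- Varying the ignored component gives `2 ^ k` indices with the common value `u`. The attacked
  -- number `u` is irrelevant; only the round that these attacks complete after stage `u` matters.
  let J : Finset ℕ := (Finset.range (2 ^ k)).image fun j =>
    2 ^ d * (2 * Nat.pair (Nat.pair e k) j + 1)
  have hJcard : J.card = 2 ^ k := by
    rw [Finset.card_image_of_injective _ fun i j hij => ?_, Finset.card_range]
    have := (Nat.pair_eq_pair.1 (two_pow_mul_odd_inj hij).2).2
    exact this
  obtain ⟨t, hut, ht⟩ := exists_attacks_add_card_le (c := c) (k := k) (u := u) (J := J) (by
    intro i hi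
    obtain ⟨j, hj, rfl⟩ := Finset.mem_image.1 hi
    refine ⟨index_lt hk.ge (Finset.mem_range.1 hj), ?_⟩
    rw [hc, hd, hsame]
    exact hu)
  rw [hJcard] at ht
  obtain ⟨x, hx, hxd⟩ := exists_mem_dropped (attacks_schedule_le c) hut ht
    (fun x hx => Finset.mem_range.1 (Finset.mem_filter.1 hx).1) hspec
  exact he (show x ∈ W e from exists_stageMem_iff.1 ⟨u, (Finset.mem_filter.1 hx).2⟩) hxd

/-! ### Comparison with Kolmogorov complexity -/

/-- The value of `U` at the string with number `n` and the empty string, as a number. -/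
def outputNum (U : Interpreter) : ℕ →. ℕ := fun n =>
  (Nat.rfindOpt fun m => (Encodable.decode (α := Str) m).bind fun p =>
    bif decide (strNum p = n) then some p else none).bind fun p =>
      (U p []).bind fun o => Part.ofOption (o.map strNum)

theorem partrec_outputNum {U : Interpreter} (hU : Partrec₂ U) : Partrec (outputNum U) := by
  have h1 : Primrec₂ fun (n m : ℕ) => (Encodable.decode (α := Str) m).bind fun p =>
      bif decide (strNum p = n) then some p else none := by
    refine Primrec.option_bind (Primrec.decode.comp Primrec.snd) ?_
    exact Primrec.cond (Primrec.eq.decide.comp (primrec_strNum.comp Primrec.snd)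
      (Primrec.fst.comp Primrec.fst)) (Primrec.option_some.comp Primrec.snd) (Primrec.const none)
  have h2 : Primrec fun o : Option Str => o.map strNum :=
    Primrec.option_map Primrec.id (primrec_strNum.comp Primrec.snd)
  have h2' : Partrec₂ fun (_ : ℕ × Str) (o : Option Str) => Part.ofOption (o.map strNum) :=
    Computable.ofOption (h2.comp Primrec.snd).to_comp
  have h3 : Partrec₂ fun (_ : ℕ) (p : Str) => (U p []).bind fun o => Part.ofOption (o.map strNum) :=
    (hU.comp Computable.snd (Computable.const [])).bind h2'
  exact (Partrec.rfindOpt h1.to_comp).bind h3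

theorem mem_outputNum {U : Interpreter} {p x : Str} (h : some x ∈ U p []) :
    strNum x ∈ outputNum U (strNum p) := by
  have hdom : (Nat.rfindOpt fun m => (Encodable.decode (α := Str) m).bind fun q =>
      bif decide (strNum q = strNum p) then some q else none).Dom :=
    Nat.rfindOpt_dom.2 ⟨Encodable.encode p, p, by simp⟩
  obtain ⟨q, hq⟩ := Part.dom_iff_mem.1 hdom
  obtain ⟨m, hm⟩ := Nat.rfindOpt_spec hq
  obtain ⟨q', -, hq'⟩ := Option.bind_eq_some_iff.1 hm
  have hqp : q = p := by
    by_cases hn : strNum q' = strNum p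
    · rw [decide_eq_true hn, cond_true] at hq'
      exact Option.some.inj hq' ▸ strNum_bijective.1 hn
    · rw [decide_eq_false hn, cond_false] at hq'
      cases hq'
  rw [outputNum, Part.eq_some_iff.2 hq, Part.bind_some, hqp, Part.mem_bind_iff]
  exact ⟨some x, h, by simp⟩

theorem exists_length_eq_iInf {S : Set Str} (hS : S.Nonempty) :
    ∃ p ∈ S, ⨅ q ∈ S, (q.length : ℕ∞) = p.length := by
  refine ⟨Function.argminOn List.length S hS, Function.argminOn_mem _ _ _, ?_⟩
  exact le_antisymm (iInf₂_le _ (Function.argminOn_mem _ _ _))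
    (le_iInf₂ fun q hq => Nat.cast_le.2 (Function.argminOn_le _ _ hq))

theorem exists_program_of_kolm_ne_top {U : Interpreter} {x : Str} (h : kolm U x ≠ ⊤) :
    ∃ p : Str, some x ∈ U p [] ∧ kolm U x = p.length := by
  refine exists_length_eq_iInf (S := {p | some x ∈ U p []}) ?_
  by_contra hne
  rw [Set.not_nonempty_iff_eq_empty] at hne
  exact h (by rw [kolm, hne]; simp)

theorem ic_le_of_kolm_eq {c : Code} (hc : eval c = universalFn) {U : Interpreter}
    (hU : IsOptimal U) : ∃ C : ℕ, ∀ x (m : ℕ), kolm U x = m → ∃ r : ℕ,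
      ic U (strNum ⁻¹' dropped (schedule c)) x ≤ r ∧ 3 * r ≤ 2 * m + C := by
  obtain ⟨d, hd⟩ := exists_index (Partrec.nat_iff.1 (partrec_outputNum hU.1))
  obtain ⟨b, -, hb, -⟩ := hU.2 _ (partrec_interp (primrec_schedule c))
  refine ⟨2 * d + 3 * b + 14, fun x m hm => ?_⟩
  obtain ⟨q, hq, hlen⟩ := exists_program_of_kolm_ne_top (by rw [hm]; exact ENat.natCast_ne_top m)
  have hqm : q.length = m := by
    rw [hm] at hlen
    exact_mod_cast hlen.symm
  -- This is the least `k` with `d + m + 2 ≤ 3 * k`, so the index of a shortest description of `x`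
  -- is below `8 ^ k`. The constant comes from `3 * (2 * (k + 1) + b) ≤ 2 * (d + m + 4) + 6 + 3 *
  -- b`.
  set k := (d + m + 4) / 3 with hk
  have hi : 2 ^ d * (2 * strNum q + 1) < 8 ^ k := by
    have h1 := (two_pow_length_le_strNum q).2
    rw [hqm] at h1
    calc 2 ^ d * (2 * strNum q + 1) < 2 ^ d * (2 * 2 ^ (m + 1)) :=
          Nat.mul_lt_mul_of_pos_left (by omega) (by positivity)
      _ = 2 ^ (d + m + 2) := by ring
      _ ≤ 2 ^ (3 * k) := Nat.pow_le_pow_right (by norm_num) (by omega)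
      _ = 8 ^ k := by rw [pow_mul]; norm_num
  obtain ⟨s, hs, -⟩ := exists_schedule (c := c) (y := strNum x)
    (by rw [hc, hd]; exact mem_outputNum hq) hi
  have h1 := ic_interp_le_of_attack (attacks_schedule_le c) hs (lt_of_schedule hs)
  refine ⟨2 * (k + 1) + b, ?_, by omega⟩
  refine (hb _ x).trans ?_
  rw [Nat.cast_add]
  exact add_le_add_left h1 _

theorem kolm_ne_top {U : Interpreter} (hU : IsOptimal U) (x : Str) : kolm U x ≠ ⊤ := by
  have hV : Partrec₂ (fun (p _ : Str) => Part.some (some p) : Interpreter) :=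
    (Computable.option_some.comp Computable.fst).partrec
  obtain ⟨b, hb, -, -⟩ := hU.2 _ hV
  have h1 : kolm (fun (p _ : Str) => Part.some (some p)) x ≤ x.length :=
    iInf₂_le (α := ℕ∞) x
      (show x ∈ {p : Str | some x ∈ Part.some (some p)} from Part.mem_some _)
  refine ne_top_of_le_ne_top (ENat.natCast_ne_top (x.length + b)) ((hb x).trans ?_)
  rw [Nat.cast_add]
  exact add_le_add_left h1 _

theorem finite_kolm_le {U : Interpreter} (M : ℕ) : {x | kolm U x ≤ M}.Finite := by
  have h : {x | kolm U x ≤ M} ⊆ ⋃ p ∈ {p : Str | p.length ≤ M}, {x | some x ∈ U p []} := by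
    intro x hx
    obtain ⟨p, hp, hlen⟩ := exists_program_of_kolm_ne_top
      (ne_top_of_le_ne_top (ENat.natCast_ne_top M) hx)
    refine Set.mem_biUnion (x := p) ?_ hp
    have hx' : kolm U x ≤ M := hx
    rw [hlen] at hx'
    exact Nat.cast_le.1 hx'
  refine Set.Finite.subset (Set.Finite.biUnion (List.finite_length_le Bool M) fun p _ => ?_) h
  exact Set.Subsingleton.finite fun x hx y hy => Option.some.inj (Part.mem_unique hx hy)

end InstanceComplexity

/-! ### The main theorem -/

theorem mainTheorem8 :
    (∀ A : Set ℕ, EffectivelySimple A → TComplete A) ∧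
    ∃ A : Set ℕ, EffectivelySimple A ∧ TComplete A ∧ ¬ ComputablePred (fun n => n ∈ A) ∧
      ∀ U : Interpreter, IsOptimal U →
        (∃ c : ℕ, ∀ x : Str,
          (ic U (strNum ⁻¹' A) x : ℝ≥0∞) ≤ (2 / 3 : ℝ≥0∞) * (kolm U x : ℝ≥0∞) + (c : ℝ≥0∞)) ∧
        ¬ HasHardInstances U (strNum ⁻¹' A) := by
  obtain ⟨c, hc⟩ := Code.exists_code.1 (Partrec.nat_iff.1 partrec_universalFn)
  have hA := effectivelySimple_dropped hc
  refine ⟨fun A hA => hA.tComplete, dropped (schedule c), hA, hA.tComplete,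
    hA.not_computablePred, fun U hU => ?_⟩
  obtain ⟨C, hC⟩ := ic_le_of_kolm_eq hc hU
  refine ⟨⟨C, fun x => ?_⟩, ?_⟩
  · obtain ⟨m, hm⟩ := ENat.ne_top_iff_exists.1 (kolm_ne_top hU x)
    obtain ⟨r, hr, hle⟩ := hC x m hm.symm
    rw [← hm]
    refine (ENat.toENNReal_le.2 hr).trans ?_
    rw [ENat.toENNReal_coe, ENat.toENNReal_coe]
    have h : (r : NNReal) ≤ 2 / 3 * m + C := by
      have h3 : (3 * r : NNReal) ≤ 2 * m + C := by exact_mod_cast hle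
      rw [← NNReal.coe_le_coe] at h3 ⊢
      push_cast at h3 ⊢
      have : (0 : ℝ) ≤ C := Nat.cast_nonneg C
      linarith
    simpa only [ENNReal.coe_add, ENNReal.coe_mul, ENNReal.coe_div three_ne_zero,
      ENNReal.coe_natCast, ENNReal.coe_ofNat] using ENNReal.coe_le_coe.2 h
  · rintro ⟨b, hb⟩
    -- A hard instance of complexity `m` has `3 * m ≤ 3 * r + 3 * b ≤ 2 * m + C + 3 * b`, hence `m ≤
    -- C + 3 * b`, which only finitely many strings satisfy.
    refine hb ((finite_kolm_le (U := U) (C + 3 * b)).subset fun x hx => ?_)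
    obtain ⟨m, hm⟩ := ENat.ne_top_iff_exists.1 (kolm_ne_top hU x)
    obtain ⟨r, hr, hle⟩ := hC x m hm.symm
    have hx' : kolm U x ≤ ic U (strNum ⁻¹' dropped (schedule c)) x + b := hx
    have h1 : kolm U x ≤ (r + b : ℕ) := by
      rw [Nat.cast_add]
      exact hx'.trans (add_le_add_left hr _)
    rw [← hm] at h1
    have h2 := Nat.cast_le.1 h1
    change kolm U x ≤ _
    rw [← hm]
    exact Nat.cast_le.2 (by omega)
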